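/- **Lemma 2.7 (Canonical duality theory).** Let $n\ge 1$, $0<R_1<R_2$, $O\in\mathbb R^n$, let $\Omega=\{x\in\mathbb R^n: R_1<|x-O|<R_2\}$ and $\Gamma=\partial\Omega=\Gamma_1\cup\Gamma_2$ (the two spheres). Let $p\in(1,2)\cup(2,\infty)$, and let $f\in C(\overline\Omega)$ be radially symmetric about $O$ with $f>0$ on $\overline\Omega$ or $f<0$ on $\overline\Omega$. Put $\chi(p)=1$ for $p\in(1,2)$, $\chi(p)=0$ for $p\in(2,\infty)$. For $\varepsilon>0$ consider $$\operatorname{div}\big((|\nabla u|^2+\chi(p)\varepsilon^2)^{(p-2)/2}\nabla u\big)+f=0\ \text{ in }\Omega,\qquad u=0\ \text{ on }\Gamma, \tag{3}$$ in the weak sense, for $u$ in $\mathscr N=\{u\in W^{1,p}_0(\Omega)\cap C(\overline\Omega): u\text{ radially symmetric}\}$. For $u\in\mathscr N$ put $\Phi_\varepsilon(u)=|\nabla u|^2+\chi(p)\varepsilon^2$ and $$I^{(\varepsilon)}[u]=\frac1p\int_\Omega\Phi_\varepsilon(u)^{p/2}dx-\int_\Omega fu\,dx .$$ Let $\Psi_*(\zeta)=\frac{p-2}{2p}(2\zeta)^{p/(p-2)}$.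 Let $\mathscr V_\varepsilon$ be the set of measurable $\zeta$ on $\Omega$ with $0<\zeta\le\varepsilon^{p-2}/2$ a.e. if $p\in(1,2)$, and the set of $\zeta\in L^{p/(p-2)}(\Omega)$ with $\zeta\ge0$ a.e. if $p\in(2,\infty)$. Put $$\Xi(u,\zeta)=\int_\Omega\{\Phi_\varepsilon(u)\zeta-\Psi_*(\zeta)-fu\}\,dx .$$ Then for every $\varepsilon>0$ there is a unique solution $\bar u_\varepsilon\in\mathscr N$ of (3), uniqueness being equality on $\overline\Omega$. Put $$\bar\zeta_\varepsilon=\tfrac12\Phi_\varepsilon(\bar u_\varepsilon)^{(p-2)/2},\qquad \theta_\varepsilon=\Phi_\varepsilon(\bar u_\varepsilon)^{(p-2)/2}\nabla\bar u_\varepsilon,$$ $$I_d^{(\varepsilon)}[\zeta]=-\frac12\int_\Omega\Big\{\frac{|\theta_\varepsilon|^2}{2\zeta}-2\chi(p)\varepsilon^2\zeta+\frac{p-2}{p}(2\zeta)^{p/(p-2)}\Big\}dx ,$$ where integrals over $\zeta\in\mathscr V_\varepsilon$ have values in $[-\infty,\infty]$, and $|\theta_\varepsilon|^2/(2\zeta)$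 is $+\infty$ where $\zeta=0\ne\theta_\varepsilon$ and $0$ where $\zeta=0=\theta_\varepsilon$. The following hold. 1. $\theta_\varepsilon$ and $\lambda_\varepsilon=2\bar\zeta_\varepsilon$ have representatives that are continuous on $\overline\Omega$. They satisfy $|\theta_\varepsilon|^2=E_{\varepsilon,p}(\lambda_\varepsilon)$ on $\overline\Omega$, where $E_{\varepsilon,p}(r)=r^{(2p-2)/(p-2)}-\chi(p)\varepsilon^2r^2$, with $\lambda_\varepsilon\in(0,\varepsilon^{p-2}]$ if $p<2$ and $\lambda_\varepsilon\in[0,\infty)$ if $p>2$. Moreover $$\bar u_\varepsilon(x)=\int_{x_0}^x\frac{\theta_\varepsilon}{\lambda_\varepsilon}\cdot dt$$ along every $C^1$ path in $\overline\Omega$ from any $x_0\in\Gamma$ to any $x\in\overline\Omega$ (the quotient is $0$ where $\lambda_\varepsilon=0$). 2. $\bar u_\varepsilon$ is a global minimizer of $I^{(\varepsilon)}$ over $\mathscr N$. 3. $\bar\zeta_\varepsilon\in\mathscr V_\varepsilon$, and it is a global minimizer over $\mathscr V_\varepsilon$ if $p\in(1,2)$, a global maximizer over $\mathscr V_\varepsilon$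 if $p\in(2,\infty)$, of $I_d^{(\varepsilon)}$ and also of $\zeta\mapsto\Xi(\bar u_\varepsilon,\zeta)$. 4. $I^{(\varepsilon)}[\bar u_\varepsilon]=\Xi(\bar u_\varepsilon,\bar\zeta_\varepsilon)=I_d^{(\varepsilon)}[\bar\zeta_\varepsilon]$. Consequently this common value equals $\min_{\mathscr N}I^{(\varepsilon)}$, and it equals $\min_{\mathscr V_\varepsilon}I_d^{(\varepsilon)}$ for $p\in(1,2)$ and $\max_{\mathscr V_\varepsilon}I_d^{(\varepsilon)}$ for $p\in(2,\infty)$. -/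

import Mathlib

open MeasureTheory Set Filter Topology
open scoped ENNReal ContDiff

noncomputable section

namespace PLap

/-- Euclidean space `ℝⁿ`. -/
abbrev E (n : ℕ) : Type := EuclideanSpace ℝ (Fin n)

/-! ### The annulus -/

/-- The open annulus `Ω` with center `O` and radii `R₁ < R₂`. -/
def annulus {n : ℕ} (O : E n) (R₁ R₂ : ℝ) : Set (E n) :=
  {x | R₁ < dist x O ∧ dist x O < R₂}

/-- The closure of the annulus. -/
def closedAnnulus {n : ℕ} (O : E n) (R₁ R₂ : ℝ) : Set (E n) :=
  {x | R₁ ≤ dist x O ∧ dist x O ≤ R₂}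

/-- The boundary `Γ = Γ₁ ∪ Γ₂` of the annulus: the two spheres. -/
def bdry {n : ℕ} (O : E n) (R₁ R₂ : ℝ) : Set (E n) :=
  Metric.sphere O R₁ ∪ Metric.sphere O R₂

/-- `u` is radially symmetric about `O` on `s`. -/
def RadialOn {n : ℕ} (O : E n) (s : Set (E n)) (u : E n → ℝ) : Prop :=
  ∀ x ∈ s, ∀ y ∈ s, dist x O = dist y O → u x = u y

/-! ### Sobolev spaces -/

/-- Test functions: smooth with compact support in `Ω`. -/
structure IsTest {n : ℕ} (Ω : Set (E n)) (φ : E n → ℝ) : Prop where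
  smooth : ContDiff ℝ ∞ φ
  compact : HasCompactSupport φ
  support : tsupport φ ⊆ Ω

/-- `G` is the weak gradient of `u` on `Ω`. -/
structure IsWeakGrad {n : ℕ} (Ω : Set (E n)) (u : E n → ℝ) (G : E n → E n) : Prop where
  locInt : LocallyIntegrableOn u Ω
  locInt_grad : LocallyIntegrableOn G Ω
  parts : ∀ φ, IsTest Ω φ → ∀ v : E n,
    ∫ x in Ω, u x * fderiv ℝ φ x v = - ∫ x in Ω, inner ℝ (G x) v * φ x

open Classical in
/-- The weak gradient `∇u` on `Ω` (unique up to a null set), `0` if there is none. -/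
def weakGrad {n : ℕ} (Ω : Set (E n)) (u : E n → ℝ) : E n → E n :=
  if h : ∃ G, IsWeakGrad Ω u G then h.choose else 0

/-- `u ∈ W₀^{1,p}(Ω)`: `u` and its weak gradient are in `L^p(Ω)`, and `u` is a limit of test
functions in the norm of `W^{1,p}(Ω)`. -/
structure MemW0 {n : ℕ} (Ω : Set (E n)) (p : ℝ) (u : E n → ℝ) : Prop where
  memLp : MemLp u (ENNReal.ofReal p) (volume.restrict Ω)
  hasGrad : IsWeakGrad Ω u (weakGrad Ω u)
  memLp_grad : MemLp (weakGrad Ω u) (ENNReal.ofReal p) (volume.restrict Ω)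
  approx : ∃ φ : ℕ → E n → ℝ, (∀ k, IsTest Ω (φ k)) ∧
    Tendsto (fun k => eLpNorm (fun x => φ k x - u x) (ENNReal.ofReal p) (volume.restrict Ω))
      atTop (𝓝 0) ∧
    Tendsto (fun k => eLpNorm (fun x => gradient (φ k) x - weakGrad Ω u x)
      (ENNReal.ofReal p) (volume.restrict Ω)) atTop (𝓝 0)

/-- The feasible space `𝒩`: radially symmetric functions in `W₀^{1,p}(Ω) ∩ C(closure of Ω)`. -/
def feasible {n : ℕ} (O : E n) (R₁ R₂ p : ℝ) : Set (E n → ℝ) :=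
  {u | MemW0 (annulus O R₁ R₂) p u ∧ ContinuousOn u (closedAnnulus O R₁ R₂) ∧
    RadialOn O (closedAnnulus O R₁ R₂) u}

/-! ### The equation and the primal energy -/

/-- The cut-off `χ(p)`: `1` on `(1,2)`, `0` on `(2,∞)`. -/
def chi (p : ℝ) : ℝ := if p < 2 then 1 else 0

/-- The geometric mapping `Φ(u) = |∇u|² + χ(p) ε²`. -/
def Phi {n : ℕ} (Ω : Set (E n)) (p ε : ℝ) (u : E n → ℝ) (x : E n) : ℝ :=
  ‖weakGrad Ω u x‖ ^ 2 + chi p * ε ^ 2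

/-- The flux `θ = (|∇u|² + χ(p) ε²)^{(p-2)/2} ∇u`. -/
def flux {n : ℕ} (Ω : Set (E n)) (p ε : ℝ) (u : E n → ℝ) (x : E n) : E n :=
  (Phi Ω p ε u x ^ ((p - 2) / 2)) • weakGrad Ω u x

/-- `u ∈ 𝒩` is a (weak) solution of `div ((|∇u|² + χ(p) ε²)^{(p-2)/2} ∇u) + f = 0` in `Ω`,
`u = 0` on `Γ`. -/
structure IsRadialSolution {n : ℕ} (O : E n) (R₁ R₂ p ε : ℝ) (f u : E n → ℝ) : Prop where
  mem : u ∈ feasible O R₁ R₂ p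
  eqn : ∀ φ, IsTest (annulus O R₁ R₂) φ →
    ∫ x in annulus O R₁ R₂, inner ℝ (flux (annulus O R₁ R₂) p ε u x) (gradient φ x) =
      ∫ x in annulus O R₁ R₂, f x * φ x
  bc : ∀ x ∈ bdry O R₁ R₂, u x = 0

/-- The primal (potential) energy
`I[u] = ∫ (|∇u|² + χ(p) ε²)^{p/2} / p - ∫ f u`. -/
def primalEnergy {n : ℕ} (Ω : Set (E n)) (p ε : ℝ) (f u : E n → ℝ) : ℝ :=
  (∫ x in Ω, Phi Ω p ε u x ^ (p / 2) / p) - ∫ x in Ω, f x * u x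

/-! ### The dual energies -/

/-- The integral, in `[-∞, ∞]`, of an extended real valued function: integral of the positive part
minus integral of the negative part. -/
def eintegral {n : ℕ} (Ω : Set (E n)) (g : E n → EReal) : EReal :=
  ((∫⁻ x in Ω, (g x).toENNReal : ℝ≥0∞) : EReal) - ((∫⁻ x in Ω, (-g x).toENNReal : ℝ≥0∞) : EReal)

/-- The Legendre transform `Ψ_*(ζ) = (p-2) (2ζ)^{p/(p-2)} / (2p)` of `Ψ(ξ) = ξ^{p/2} / p`. -/
def PsiStar (p ζ : ℝ) : ℝ := (p - 2) * (2 * ζ) ^ (p / (p - 2)) / (2 * p)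

/-- The dual variable `ζ = Ψ'(ξ) = ξ^{(p-2)/2} / 2`, `ξ = Φ(u)`, that belongs to `u`. -/
def dualVar {n : ℕ} (Ω : Set (E n)) (p ε : ℝ) (u : E n → ℝ) (x : E n) : ℝ :=
  Phi Ω p ε u x ^ ((p - 2) / 2) / 2

/-- The dual space `𝒱`: `0 < ζ ≤ ε^{p-2}/2` for `p < 2`, nonnegative functions in
`L^{p/(p-2)}(Ω)` for `p > 2`. -/
def dualSpace {n : ℕ} (Ω : Set (E n)) (p ε : ℝ) : Set (E n → ℝ) :=
  if p < 2 then
    {ζ | AEStronglyMeasurable ζ (volume.restrict Ω) ∧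
      ∀ᵐ x ∂(volume.restrict Ω), 0 < ζ x ∧ ζ x ≤ ε ^ (p - 2) / 2}
  else
    {ζ | MemLp ζ (ENNReal.ofReal (p / (p - 2))) (volume.restrict Ω) ∧
      ∀ᵐ x ∂(volume.restrict Ω), 0 ≤ ζ x}

/-- The total complementary energy `Ξ(u, ζ) = ∫ Φ(u) ζ - Ψ_*(ζ) - f u`. -/
def totalEnergy {n : ℕ} (Ω : Set (E n)) (p ε : ℝ) (f u ζ : E n → ℝ) : EReal :=
  eintegral Ω fun x => ((Phi Ω p ε u x * ζ x - PsiStar p (ζ x) - f x * u x : ℝ) : EReal)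

/-- The pure complementary energy
`I_d[ζ] = -1/2 ∫ |θ|²/(2ζ) - 2 χ(p) ε² ζ + (p-2) (2ζ)^{p/(p-2)} / p`, where `θ` is the flux of
the solution `u`. The factor `-1/2` is multiplied into the integrand. The quotient is taken in
`[0, ∞]`, so that it is `∞` where `ζ = 0 ≠ θ` and `0` where `ζ = 0 = θ`. -/
def pureEnergy {n : ℕ} (Ω : Set (E n)) (p ε : ℝ) (u ζ : E n → ℝ) : EReal :=
  eintegral Ω fun x =>
    ((chi p * ε ^ 2 * ζ x - PsiStar p (ζ x) : ℝ) : EReal) -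
      ((ENNReal.ofReal (‖flux Ω p ε u x‖ ^ 2) / ENNReal.ofReal (4 * ζ x) : ℝ≥0∞) : EReal)

/-! ### The explicit form of the solution -/

/-- `E_{ε,p}(r) = r^{(2p-2)/(p-2)} - χ(p) ε² r²`. -/
def Efun (ε p r : ℝ) : ℝ := r ^ ((2 * p - 2) / (p - 2)) - chi p * ε ^ 2 * r ^ 2

/-- The interval on which `E_{ε,p}` is inverted: `(0, ε^{p-2}]` for `p < 2`, `[0, ∞)` for
`p > 2`. -/
def Edom (ε p : ℝ) : Set ℝ := if p < 2 then Ioc 0 (ε ^ (p - 2)) else Ici 0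

/-- `u(x) = ∫_{x₀}^{x} (θ / lam) · dt` for every `x₀ ∈ Γ` and every `C¹` path from `x₀` to `x` in
the closed annulus. Here `θ` and `lam` are the continuous representatives of the flux and of twice
the dual variable of `u`, and `lam = E_{ε,p}⁻¹(|θ|²)` on the closed annulus. Where `lam = 0` one
has `θ = 0`, and the quotient is `0`. -/
def HasLineIntegralForm {n : ℕ} (O : E n) (R₁ R₂ p ε : ℝ) (u : E n → ℝ) : Prop :=
  ∃ (θ : E n → E n) (lam : E n → ℝ),
    ContinuousOn θ (closedAnnulus O R₁ R₂) ∧ ContinuousOn lam (closedAnnulus O R₁ R₂) ∧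
    θ =ᵐ[volume.restrict (annulus O R₁ R₂)] flux (annulus O R₁ R₂) p ε u ∧
    (∀ᵐ x ∂(volume.restrict (annulus O R₁ R₂)),
      lam x = 2 * dualVar (annulus O R₁ R₂) p ε u x) ∧
    (∀ x ∈ closedAnnulus O R₁ R₂, lam x ∈ Edom ε p ∧ Efun ε p (lam x) = ‖θ x‖ ^ 2) ∧
    ∀ (x₀ x : E n) (γ : Path x₀ x), x₀ ∈ bdry O R₁ R₂ →
      ContDiffOn ℝ 1 γ.extend (Icc 0 1) → (∀ t, γ t ∈ closedAnnulus O R₁ R₂) →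
      u x = curveIntegral (fun y => innerSL ℝ ((lam y)⁻¹ • θ y)) γ

end PLap

end

noncomputable section

namespace PLap

/-! For a radial function with radial derivative `g`, the equation becomes an ODE for the flux. A
field `S(r)(x - O)` has divergence `n S + r S'`, so the equation reads `(rⁿ S)' = -rⁿ⁻¹ F`, and `S`
is explicit up to one constant `c`. The scalar flux `flow p δ`, with `δ = χ(p) ε²`, is an increasing
homeomorphism of the line (`flow_strictMono`, `flow_surjective`). Hence `g` is recovered from `flow
p δ (g r) = r S(r)`, and the intermediate value theorem supplies a `c` with `∫ g = 0`, which is the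
boundary condition on both spheres (`exists_radial_derivative`). The function obtained has a
classical continuous gradient `θ/λ`, which gives the line integral formula. It lies in `W₀^{1,p}` by
explicit radial test functions (`memW0_radial`).

By density the weak equation may be tested with every `W₀^{1,p}` function (`MemW0.weak_eq_flux`).
Three conclusions rest on this. Strict monotonicity of the flux forces two solutions to have the
same gradient, and a radial dual field then forces the functions to agree
(`eqOn_of_weakGrad_ae_eq`). Convexity of the energy density gives the primal minimum, because the
linear term of the tangent inequality cancels against the load. Testing with the solution itself
closes the duality gap.

The dual statements are pointwise inequalities integrated over `Ω`. The function `Ψ(ξ) = ξ^{p/2}/p`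
is convex for `p > 2` and concave for `p < 2`, which is why the dual problem is a maximum in one
regime and a minimum in the other. The Legendre inequalities are weighted arithmetic-geometric mean
inequalities (`legendre_le`, `le_legendre`). The pure complementary density is handled by completing
a square for `p > 2` (`pure_le`) and by a separate convexity argument for `p < 2` (`le_pure`). -/

/-! ### The scalar nonlinearity -/

/-- The two regimes of the exponent `p` and the regularization parameter `δ`. -/
structure Regime (p δ : ℝ) : Prop where
  one_lt : 1 < p
  cases : (p < 2 ∧ 0 < δ) ∨ (2 < p ∧ δ = 0)

namespace Regime

variable {p δ : ℝ}

lemma nonneg (h : Regime p δ) : 0 ≤ δ := by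
  rcases h.cases with h | h
  · exact h.2.le
  · exact h.2.ge

lemma p_pos (h : Regime p δ) : 0 < p := by linarith [h.one_lt]

/-- The base of the real powers degenerates only at a critical point in the regime `p > 2`. This
isolates the one place where power laws need a separate check. -/
lemma base_pos_or (h : Regime p δ) (s : ℝ) :
    0 < s ^ 2 + δ ∨ (2 < p ∧ δ = 0 ∧ s = 0) := by
  rcases h.cases with h | h
  · left; nlinarith [sq_nonneg s]
  · by_cases hs : s = 0
    · right; exact ⟨h.1, h.2, hs⟩
    · left; rw [h.2, add_zero]; positivity

lemma base_nonneg (h : Regime p δ) (s : ℝ) : 0 ≤ s ^ 2 + δ := by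
  have := h.nonneg; positivity

end Regime

lemma regime_chi {p ε : ℝ} (hp : 1 < p) (hp2 : p ≠ 2) (hε : 0 < ε) :
    Regime p (chi p * ε ^ 2) := by
  refine ⟨hp, ?_⟩
  rcases lt_or_gt_of_ne hp2 with h | h
  · left; refine ⟨h, ?_⟩; rw [chi, if_pos h]; positivity
  · right; refine ⟨h, ?_⟩; rw [chi, if_neg h.not_gt, zero_mul]

/-- The one-dimensional flux `s ↦ (s² + δ)^{(p-2)/2} s`. -/
def flow (p δ s : ℝ) : ℝ := (s ^ 2 + δ) ^ ((p - 2) / 2) * s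

/-- The one-dimensional energy density `s ↦ (s² + δ)^{p/2} / p`. -/
def dens (p δ s : ℝ) : ℝ := (s ^ 2 + δ) ^ (p / 2) / p

section scalar

variable {p δ : ℝ}

lemma flow_zero : flow p δ 0 = 0 := by simp [flow]

lemma flow_neg (s : ℝ) : flow p δ (-s) = -flow p δ s := by simp [flow]

lemma coeff_sq (h : Regime p δ) (s : ℝ) :
    ((s ^ 2 + δ) ^ ((p - 2) / 2)) ^ 2 = (s ^ 2 + δ) ^ (p - 2) := by
  rw [← Real.rpow_natCast, ← Real.rpow_mul (h.base_nonneg s)]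
  congr 1; push_cast; ring

/-- Write `s² = (s² + δ) - δ`. The square thus becomes a difference of powers of the same base,
which serves both monotonicity and the relation `Efun`. -/
lemma flow_sq (h : Regime p δ) (s : ℝ) :
    flow p δ s ^ 2 = (s ^ 2 + δ) ^ (p - 1) - δ * (s ^ 2 + δ) ^ (p - 2) := by
  rw [flow, mul_pow, coeff_sq h]
  rcases h.base_pos_or s with hs | ⟨hp, rfl, rfl⟩
  · have : (s ^ 2 + δ) ^ (p - 1) = (s ^ 2 + δ) ^ (p - 2) * (s ^ 2 + δ) := by
      rw [← Real.rpow_add_one hs.ne']; congr 1; ring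
    rw [this]; ring
  · have h1 := h.one_lt
    simp [Real.zero_rpow (by linarith : p - 1 ≠ 0)]

lemma correction_le (h : Regime p δ) {s t : ℝ} (hs : 0 ≤ s) (hst : s ≤ t) :
    δ * (t ^ 2 + δ) ^ (p - 2) ≤ δ * (s ^ 2 + δ) ^ (p - 2) := by
  rcases h.cases with ⟨hp, hδ⟩ | ⟨hp, rfl⟩
  · refine mul_le_mul_of_nonneg_left ?_ hδ.le
    exact Real.rpow_le_rpow_of_nonpos (by positivity) (by gcongr) (by linarith)
  · simp

lemma flow_nonneg (h : Regime p δ) {s : ℝ} (hs : 0 ≤ s) : 0 ≤ flow p δ s :=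
  mul_nonneg (Real.rpow_nonneg (h.base_nonneg s) _) hs

/-- For `p < 2` the coefficient decreases in `|s|`, so the product form is inconclusive. In the
squared form the power with exponent `p - 1 > 0` is strictly increasing and the subtracted
correction is nonincreasing on `s ≥ 0`. Oddness gives the rest of the line. -/
lemma flow_strictMono (h : Regime p δ) : StrictMono (flow p δ) := by
  refine strictMono_of_odd_strictMonoOn_nonneg flow_neg ?_
  intro s hs t ht hst
  have hs' : 0 ≤ s := hs
  refine lt_of_pow_lt_pow_left₀ 2 (flow_nonneg h ht) ?_
  rw [flow_sq h, flow_sq h]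
  have h1 := correction_le h hs' hst.le
  have h2 : (s ^ 2 + δ) ^ (p - 1) < (t ^ 2 + δ) ^ (p - 1) :=
    Real.rpow_lt_rpow (h.base_nonneg s) (by gcongr) (by linarith [h.one_lt])
  linarith

lemma continuous_coeff (h : Regime p δ) : Continuous fun s : ℝ => (s ^ 2 + δ) ^ ((p - 2) / 2) := by
  refine Continuous.rpow_const (by fun_prop) fun s => ?_
  rcases h.base_pos_or s with hs | ⟨hp, -, -⟩
  · exact Or.inl hs.ne'
  · right; linarith

lemma continuous_flow (h : Regime p δ) : Continuous (flow p δ) :=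
  (continuous_coeff h).mul continuous_id

lemma tendsto_flow_atTop (h : Regime p δ) : Tendsto (flow p δ) atTop atTop := by
  have h2 : Tendsto (fun s => flow p δ s ^ 2) atTop atTop := by
    have h3 : Tendsto (fun s : ℝ => (s ^ 2 + δ) ^ (p - 1) + -(δ * (0 ^ 2 + δ) ^ (p - 2)))
        atTop atTop := by
      refine tendsto_atTop_add_const_right _ _ ?_
      refine (tendsto_rpow_atTop (by linarith [h.one_lt])).comp ?_
      exact tendsto_atTop_add_const_right _ _ (tendsto_pow_atTop two_ne_zero)
    refine tendsto_atTop_mono' _ ?_ h3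
    filter_upwards [eventually_ge_atTop 0] with s hs
    rw [flow_sq h]
    linarith [correction_le h le_rfl hs]
  rw [tendsto_atTop]
  intro b
  filter_upwards [h2.eventually_ge_atTop (b ^ 2), eventually_ge_atTop 0] with s hs hs0
  exact (abs_le_of_sq_le_sq' hs (flow_nonneg h hs0)).2

lemma flow_surjective (h : Regime p δ) : Function.Surjective (flow p δ) := by
  refine (continuous_flow h).surjective (tendsto_flow_atTop h) ?_
  have := tendsto_neg_atTop_atBot.comp ((tendsto_flow_atTop h).comp tendsto_neg_atBot_atTop)
  refine this.congr fun s => ?_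
  simp [flow_neg]

/-- The inverse of the one-dimensional flux. -/
lemma exists_flow_inverse (h : Regime p δ) : ∃ g : ℝ → ℝ, Continuous g ∧ Monotone g ∧ g 0 = 0 ∧
    ∀ y, flow p δ (g y) = y := by
  let e := StrictMono.orderIsoOfSurjective _ (flow_strictMono h) (flow_surjective h)
  have he : ∀ y, flow p δ (e.symm y) = y := fun y => e.apply_symm_apply y
  refine ⟨e.symm, e.symm.continuous, e.symm.monotone, ?_, he⟩
  apply (flow_strictMono h).injective
  rw [he, flow_zero]

lemma hasDerivAt_dens (h : Regime p δ) (s : ℝ) : HasDerivAt (dens p δ) (flow p δ s) s := by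
  have h0 : HasDerivAt (fun s : ℝ => s ^ 2 + δ) (2 * s) s := by
    simpa using (hasDerivAt_pow 2 s).add_const δ
  have h1 := (h0.rpow_const (p := p / 2) (by
    rcases h.base_pos_or s with hs | ⟨hp, -, -⟩
    · exact Or.inl hs.ne'
    · right; linarith)).div_const p
  refine h1.congr_deriv ?_
  have hp := h.p_pos
  have : p / 2 - 1 = (p - 2) / 2 := by ring
  rw [flow, this]; field_simp

/-- Convexity: the derivative of `dens` is the increasing function `flow`, and the mean value
theorem compares the slope with its value at `s`. -/
lemma dens_tangent (h : Regime p δ) (s t : ℝ) :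
    dens p δ s + flow p δ s * (t - s) ≤ dens p δ t := by
  have hc : Continuous (dens p δ) :=
    continuous_iff_continuousAt.2 fun s => (hasDerivAt_dens h s).continuousAt
  have hm := (flow_strictMono h).monotone
  rcases lt_trichotomy s t with hst | rfl | hst
  · obtain ⟨ξ, hξ, he⟩ := exists_hasDerivAt_eq_slope (dens p δ) (flow p δ) hst hc.continuousOn
      fun x _ => hasDerivAt_dens h x
    rw [eq_div_iff (by linarith)] at he
    nlinarith [hm hξ.1.le]
  · simp
  · obtain ⟨ξ, hξ, he⟩ := exists_hasDerivAt_eq_slope (dens p δ) (flow p δ) hst hc.continuousOn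
      fun x _ => hasDerivAt_dens h x
    rw [eq_div_iff (by linarith)] at he
    nlinarith [hm hξ.2.le]

end scalar

/-! ### Vector inequalities -/

section vector

variable {p δ : ℝ} {V : Type*} [NormedAddCommGroup V] [InnerProductSpace ℝ V]

lemma dens_tangent_vec (h : Regime p δ) (a b : V) :
    dens p δ ‖a‖ + inner ℝ ((‖a‖ ^ 2 + δ) ^ ((p - 2) / 2) • a) (b - a) ≤ dens p δ ‖b‖ := by
  have h1 := dens_tangent h ‖a‖ ‖b‖
  have h2 : inner ℝ ((‖a‖ ^ 2 + δ) ^ ((p - 2) / 2) • a) (b - a) ≤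
      flow p δ ‖a‖ * (‖b‖ - ‖a‖) := by
    rw [real_inner_smul_left, inner_sub_right, real_inner_self_eq_norm_sq, flow, mul_assoc]
    refine mul_le_mul_of_nonneg_left ?_ (Real.rpow_nonneg (h.base_nonneg _) _)
    nlinarith [real_inner_le_norm a b]
  linarith

/-- The two sides differ by `(α + β)(‖a‖‖b‖ - ⟨a, b⟩)`, so Cauchy–Schwarz reduces vector
monotonicity to that of the scalar flux. -/
lemma flux_monotone_aux (a b : V) (α β : ℝ) (hα : 0 ≤ α) (hβ : 0 ≤ β) :
    (α * ‖a‖ - β * ‖b‖) * (‖a‖ - ‖b‖) ≤ inner ℝ (α • a - β • b) (a - b) := by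
  have e : inner ℝ (α • a - β • b) (a - b) =
      α * ‖a‖ ^ 2 + β * ‖b‖ ^ 2 - (α + β) * inner ℝ a b := by
    simp only [inner_sub_left, inner_sub_right, real_inner_smul_left, real_inner_self_eq_norm_sq,
      real_inner_comm a b]
    ring
  rw [e]
  nlinarith [mul_le_mul_of_nonneg_left (real_inner_le_norm a b) (add_nonneg hα hβ)]

lemma flux_monotone (h : Regime p δ) (a b : V) :
    0 ≤ inner ℝ ((‖a‖ ^ 2 + δ) ^ ((p - 2) / 2) • a - (‖b‖ ^ 2 + δ) ^ ((p - 2) / 2) • b)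
      (a - b) := by
  refine le_trans ?_ (flux_monotone_aux a b _ _ (Real.rpow_nonneg (h.base_nonneg _) _)
    (Real.rpow_nonneg (h.base_nonneg _) _))
  change 0 ≤ (flow p δ ‖a‖ - flow p δ ‖b‖) * (‖a‖ - ‖b‖)
  have hm := (flow_strictMono h).monotone
  rcases le_total ‖a‖ ‖b‖ with hab | hab
  · nlinarith [hm hab]
  · nlinarith [hm hab]

/-- Strict scalar monotonicity makes the norms equal, hence the coefficients too. What remains is
the common coefficient times `‖a - b‖²`. -/
lemma eq_of_flux_inner_eq_zero (h : Regime p δ) (a b : V)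
    (h0 : inner ℝ ((‖a‖ ^ 2 + δ) ^ ((p - 2) / 2) • a - (‖b‖ ^ 2 + δ) ^ ((p - 2) / 2) • b)
      (a - b) = 0) : a = b := by
  have h1 := flux_monotone_aux a b _ _ (Real.rpow_nonneg (h.base_nonneg ‖a‖) ((p - 2) / 2))
    (Real.rpow_nonneg (h.base_nonneg ‖b‖) ((p - 2) / 2))
  rw [h0] at h1
  change (flow p δ ‖a‖ - flow p δ ‖b‖) * (‖a‖ - ‖b‖) ≤ 0 at h1
  have hm := flow_strictMono h
  have hn : ‖a‖ = ‖b‖ := by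
    rcases lt_trichotomy ‖a‖ ‖b‖ with hab | hab | hab
    · nlinarith [hm hab]
    · exact hab
    · nlinarith [hm hab]
  rw [hn, ← smul_sub, real_inner_smul_left, real_inner_self_eq_norm_sq] at h0
  rcases mul_eq_zero.1 h0 with h2 | h2
  · rcases h.base_pos_or ‖b‖ with hs | ⟨-, -, hb⟩
    · exact absurd h2 (Real.rpow_pos_of_pos hs _).ne'
    · rw [norm_eq_zero.1 hb, norm_eq_zero.1 (hn.trans hb)]
  · exact sub_eq_zero.1 (norm_eq_zero.1 (pow_eq_zero_iff two_ne_zero |>.1 h2))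

end vector

/-! ### The pointwise duality inequalities -/

section dual

variable {p δ : ℝ}

/-- The Legendre identity at the dual variable. -/
lemma legendre_eq (h : Regime p δ) (s : ℝ) :
    (s ^ 2 + δ) * ((s ^ 2 + δ) ^ ((p - 2) / 2) / 2) -
      PsiStar p ((s ^ 2 + δ) ^ ((p - 2) / 2) / 2) = dens p δ s := by
  have hp := h.p_pos
  have hp2 : p - 2 ≠ 0 := by
    rcases h.cases with h | h <;> intro h' <;> linarith [h.1]
  have e1 : (2 * ((s ^ 2 + δ) ^ ((p - 2) / 2) / 2)) ^ (p / (p - 2)) = (s ^ 2 + δ) ^ (p / 2) := by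
    rw [mul_div_cancel₀ _ two_ne_zero, ← Real.rpow_mul (h.base_nonneg s)]
    congr 1; field_simp
  have e2 : (s ^ 2 + δ) * (s ^ 2 + δ) ^ ((p - 2) / 2) = (s ^ 2 + δ) ^ (p / 2) := by
    rcases h.base_pos_or s with hs | ⟨hp, rfl, rfl⟩
    · nth_rw 1 [← Real.rpow_one (s ^ 2 + δ)]
      rw [← Real.rpow_add hs]; congr 1; ring
    · have : p / 2 ≠ 0 := by positivity
      simp [Real.zero_rpow this]
  rw [PsiStar, e1, dens, mul_div_assoc', e2]
  field_simp
  ring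

/-- Tangent line inequality for powers with exponent at least one. -/
lemma rpow_tangent {a x y : ℝ} (ha : 1 ≤ a) (hx : 0 < x) (hy : 0 ≤ y) :
    x ^ a + a * x ^ (a - 1) * (y - x) ≤ y ^ a := by
  have h1 := one_add_mul_self_le_rpow_one_add (s := y / x - 1) (p := a)
    (by have : 0 ≤ y / x := by positivity
        linarith) ha
  rw [add_sub_cancel, Real.div_rpow hy hx.le, le_div_iff₀ (Real.rpow_pos_of_pos hx a)] at h1
  refine le_trans (le_of_eq ?_) h1
  have : x ^ a = x ^ (a - 1) * x := by rw [← Real.rpow_add_one hx.ne']; congr 1; ring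
  rw [this]; field_simp

/-- Young's inequality for `Φ · 2ζ` with conjugate exponents `p/2` and `p/(p-2)`. -/
lemma legendre_le (h : Regime p δ) (hp2 : 2 < p) (s : ℝ) {ζ : ℝ} (hζ : 0 ≤ ζ) :
    (s ^ 2 + δ) * ζ - PsiStar p ζ ≤ dens p δ s := by
  have hp := h.p_pos
  have hp2' : 0 < p - 2 := by linarith
  have hΦ := h.base_nonneg s
  set Φ := s ^ 2 + δ with hΦd
  have hy := Real.geom_mean_le_arith_mean2_weighted (w₁ := 2 / p) (w₂ := (p - 2) / p)
    (p₁ := Φ ^ (p / 2)) (p₂ := (2 * ζ) ^ (p / (p - 2))) (by positivity) (by positivity)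
    (by positivity) (by positivity) (by field_simp; ring)
  rw [← Real.rpow_mul hΦ, ← Real.rpow_mul (by positivity)] at hy
  have e1 : p / 2 * (2 / p) = 1 := by field_simp
  have e2 : p / (p - 2) * ((p - 2) / p) = 1 := by field_simp
  rw [e1, e2, Real.rpow_one, Real.rpow_one] at hy
  rw [PsiStar, dens, ← hΦd]
  have e3 : (p - 2) * (2 * ζ) ^ (p / (p - 2)) / (2 * p) =
      ((p - 2) / p * (2 * ζ) ^ (p / (p - 2))) / 2 := by field_simp
  have e4 : Φ ^ (p / 2) / p = (2 / p * Φ ^ (p / 2)) / 2 := by field_simp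
  rw [e3, e4]
  linarith

/-- For `p < 2` the exponent `p/(p-2)` is negative and Young's inequality reverses. The weights
`p/2` and `(2-p)/2`, applied to `Φ · 2ζ` and `(2ζ)^{p/(p-2)}`, make the powers of `2ζ` cancel in the
geometric mean and leave `Φ^{p/2}`. -/
lemma le_legendre (h : Regime p δ) (hp2 : p < 2) (s : ℝ) {ζ : ℝ} (hζ : 0 < ζ) :
    dens p δ s ≤ (s ^ 2 + δ) * ζ - PsiStar p ζ := by
  have hp := h.p_pos
  have hp2' : 0 < 2 - p := by linarith
  have hp2'' : p - 2 ≠ 0 := by linarith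
  have hΦ := h.base_nonneg s
  set Φ := s ^ 2 + δ with hΦd
  have hl : 0 < 2 * ζ := by positivity
  have hy := Real.geom_mean_le_arith_mean2_weighted (w₁ := p / 2) (w₂ := (2 - p) / 2)
    (p₁ := Φ * (2 * ζ)) (p₂ := (2 * ζ) ^ (p / (p - 2))) (by positivity) (by positivity)
    (by positivity) (by positivity) (by ring)
  rw [Real.mul_rpow hΦ hl.le, ← Real.rpow_mul hl.le, mul_assoc, ← Real.rpow_add hl] at hy
  have e1 : p / 2 + p / (p - 2) * ((2 - p) / 2) = 0 := by field_simp; ring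
  rw [e1, Real.rpow_zero, mul_one] at hy
  rw [PsiStar, dens, ← hΦd, div_le_iff₀ hp]
  have e3 : (Φ * ζ - (p - 2) * (2 * ζ) ^ (p / (p - 2)) / (2 * p)) * p =
      p / 2 * (Φ * (2 * ζ)) + (2 - p) / 2 * (2 * ζ) ^ (p / (p - 2)) := by field_simp; ring
  rw [e3]
  exact hy

/-- Pointwise optimality of the dual variable for the pure complementary density. -/
lemma pure_le (h : Regime p δ) (hp2 : 2 < p) (s : ℝ) {ζ : ℝ} (hζ : 0 < ζ) :
    δ * ζ - PsiStar p ζ - ((s ^ 2 + δ) ^ ((p - 2) / 2) * s) ^ 2 / (4 * ζ) ≤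
      dens p δ s - (s ^ 2 + δ) ^ ((p - 2) / 2) * s ^ 2 := by
  have h1 := legendre_le h hp2 s hζ.le
  set L := (s ^ 2 + δ) ^ ((p - 2) / 2)
  -- Completing a square trades the quotient for `s² ζ`, which turns the pure density into the
  -- Legendre density.
  have h2 : L * s ^ 2 ≤ (L * s) ^ 2 / (4 * ζ) + s ^ 2 * ζ := by
    have : (L * s) ^ 2 / (4 * ζ) + s ^ 2 * ζ - L * s ^ 2 = s ^ 2 * (L - 2 * ζ) ^ 2 / (4 * ζ) := by
      field_simp; ring
    have h3 : 0 ≤ s ^ 2 * (L - 2 * ζ) ^ 2 / (4 * ζ) := by positivity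
    linarith
  linarith

/-- Completing the square as in `pure_le` now points the wrong way. In the variable `m = 1/(2ζ)` the
right side is `δ/(2m)` plus a positive multiple of `m^{p/(2-p)}` minus a linear term, which is
convex since `p/(2-p) ≥ 1`. Its critical point is `k = Φ^{(2-p)/2}`: the tangent lines at `k` add up
with total slope zero. -/
lemma le_pure (h : Regime p δ) (hp2 : p < 2) (s : ℝ) {ζ : ℝ} (hζ : 0 < ζ) :
    dens p δ s - (s ^ 2 + δ) ^ ((p - 2) / 2) * s ^ 2 ≤
      δ * ζ - PsiStar p ζ - ((s ^ 2 + δ) ^ ((p - 2) / 2) * s) ^ 2 / (4 * ζ) := by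
  have hp := h.one_lt
  have hp2' : 0 < 2 - p := by linarith
  have hp2'' : p - 2 ≠ 0 := by linarith
  have hδ := h.nonneg
  have hΦ : 0 < s ^ 2 + δ := by
    rcases h.base_pos_or s with h | h
    · exact h
    · linarith [h.1]
  have hs : s ^ 2 = (s ^ 2 + δ) - δ := by ring
  rw [dens, mul_pow]
  set Φ := s ^ 2 + δ with hΦd
  rw [hs]
  obtain ⟨m, hm, hmζ⟩ : ∃ m : ℝ, 0 < m ∧ ζ = 1 / (2 * m) :=
    ⟨1 / (2 * ζ), by positivity, by field_simp⟩
  set k := Φ ^ ((2 - p) / 2) with hk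
  have hk0 : 0 < k := Real.rpow_pos_of_pos hΦ _
  have eL : Φ ^ ((p - 2) / 2) = 1 / k := by
    rw [hk, one_div, ← Real.rpow_neg hΦ.le]; congr 1; ring
  have eP : (2 * ζ) ^ (p / (p - 2)) = m ^ (p / (2 - p)) := by
    have : 2 * ζ = m⁻¹ := by rw [hmζ]; field_simp
    rw [this, Real.inv_rpow hm.le, ← Real.rpow_neg hm.le]
    congr 1
    rw [← div_neg, neg_sub]
  have ht := rpow_tangent (a := p / (2 - p)) (x := k) (y := m)
    (by rw [le_div_iff₀ hp2']; linarith) hk0 hm.le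
  have e1 : k ^ (p / (2 - p)) = Φ ^ (p / 2) := by
    rw [hk, ← Real.rpow_mul hΦ.le]; congr 1; field_simp
  have e2 : k ^ (p / (2 - p) - 1) = Φ ^ (p - 1) := by
    rw [hk, ← Real.rpow_mul hΦ.le]; congr 1; field_simp; ring
  have e3 : Φ ^ (p / 2) = Φ / k := by
    rw [hk, eq_div_iff (Real.rpow_pos_of_pos hΦ _).ne', ← Real.rpow_add hΦ]
    convert Real.rpow_one Φ using 2; ring
  have e4 : Φ ^ (p - 1) = Φ / k ^ 2 := by
    rw [hk, eq_div_iff (by positivity), ← Real.rpow_natCast, ← Real.rpow_mul hΦ.le,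
      ← Real.rpow_add hΦ]
    convert Real.rpow_one Φ using 2; push_cast; ring
  rw [e1, e2, e4, e3] at ht
  rw [PsiStar, eP, eL, e3]
  have h1 : δ / k ^ 2 * (2 * k - m) ≤ δ / m := by
    have : δ / m - δ / k ^ 2 * (2 * k - m) = δ * (k - m) ^ 2 / (m * k ^ 2) := by
      field_simp; ring
    have h3 : 0 ≤ δ * (k - m) ^ 2 / (m * k ^ 2) := by positivity
    linarith
  have e5 : δ * ζ - (p - 2) * m ^ (p / (2 - p)) / (2 * p) -
      (1 / k) ^ 2 * (Φ - δ) / (4 * ζ) =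
      δ / m / 2 + (2 - p) / (2 * p) * m ^ (p / (2 - p)) - (Φ - δ) * m / (2 * k ^ 2) := by
    rw [hmζ]; field_simp; ring
  rw [e5]
  have ht' := mul_le_mul_of_nonneg_left ht (by positivity : 0 ≤ (2 - p) / (2 * p))
  refine le_trans (le_of_eq ?_) (sub_le_sub_right (add_le_add
    (div_le_div_of_nonneg_right h1 zero_le_two) ht') _)
  field_simp
  ring

lemma pure_eq (h : Regime p δ) {s : ℝ} (hs : 0 < s ^ 2 + δ) :
    δ * ((s ^ 2 + δ) ^ ((p - 2) / 2) / 2) - PsiStar p ((s ^ 2 + δ) ^ ((p - 2) / 2) / 2) -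
      ((s ^ 2 + δ) ^ ((p - 2) / 2) * s) ^ 2 / (4 * ((s ^ 2 + δ) ^ ((p - 2) / 2) / 2)) =
      dens p δ s - (s ^ 2 + δ) ^ ((p - 2) / 2) * s ^ 2 := by
  have h1 := legendre_eq h s
  have hL := Real.rpow_pos_of_pos hs ((p - 2) / 2)
  set L := (s ^ 2 + δ) ^ ((p - 2) / 2)
  have : (L * s) ^ 2 / (4 * (L / 2)) = L * s ^ 2 / 2 := by field_simp; norm_num
  rw [this, ← h1]
  ring

end dual

/-! ### The algebraic relation between flux and dual variable -/

lemma Efun_coeff {p ε : ℝ} (h : Regime p (chi p * ε ^ 2)) (s : ℝ) :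
    Efun ε p ((s ^ 2 + chi p * ε ^ 2) ^ ((p - 2) / 2)) =
      ((s ^ 2 + chi p * ε ^ 2) ^ ((p - 2) / 2) * s) ^ 2 := by
  have h2 := flow_sq h s
  rw [flow] at h2
  have hp2 : p - 2 ≠ 0 := by
    rcases h.cases with h | h <;> intro h' <;> linarith [h.1]
  rw [h2, Efun, coeff_sq h, ← Real.rpow_mul (h.base_nonneg s)]
  congr 2
  field_simp

lemma coeff_mem_Edom {p ε : ℝ} (h : Regime p (chi p * ε ^ 2)) (hε : 0 < ε) (s : ℝ) :
    (s ^ 2 + chi p * ε ^ 2) ^ ((p - 2) / 2) ∈ Edom ε p := by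
  rw [Edom]
  split_ifs with hp
  · have hΦ : 0 < s ^ 2 + chi p * ε ^ 2 := by
      rcases h.base_pos_or s with h | h
      · exact h
      · linarith [h.1]
    refine ⟨Real.rpow_pos_of_pos hΦ _, ?_⟩
    -- The upper end of the interval is the coefficient at `s = 0`; the negative exponent makes this
    -- its largest value.
    have e : ε ^ (p - 2) = (ε ^ 2) ^ ((p - 2) / 2) := by
      rw [← Real.rpow_natCast, ← Real.rpow_mul hε.le]; congr 1; push_cast; ring
    rw [e]
    refine Real.rpow_le_rpow_of_nonpos (by positivity) ?_ (by linarith)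
    rw [chi, if_pos hp]
    nlinarith [sq_nonneg s]
  · exact Real.rpow_nonneg (h.base_nonneg s) _

/-! ### Geometry of the annulus -/

section geometry

variable {n : ℕ} {O : E n} {R₁ R₂ : ℝ}

lemma isOpen_annulus : IsOpen (annulus O R₁ R₂) :=
  (isOpen_lt (f := fun _ : E n => R₁) (g := fun x => dist x O)
    continuous_const (by fun_prop)).inter
    (isOpen_lt (f := fun x => dist x O) (g := fun _ : E n => R₂) (by fun_prop) continuous_const)

lemma measurableSet_annulus : MeasurableSet (annulus O R₁ R₂) := isOpen_annulus.measurableSet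

lemma isCompact_closedAnnulus : IsCompact (closedAnnulus O R₁ R₂) := by
  refine (isCompact_closedBall O R₂).of_isClosed_subset ?_ fun x hx => hx.2
  exact (isClosed_le (f := fun _ : E n => R₁) (g := fun x => dist x O)
    continuous_const (by fun_prop)).inter
    (isClosed_le (f := fun x => dist x O) (g := fun _ : E n => R₂) (by fun_prop) continuous_const)

lemma annulus_subset : annulus O R₁ R₂ ⊆ closedAnnulus O R₁ R₂ := fun _ hx => ⟨hx.1.le, hx.2.le⟩

instance isFiniteMeasure_annulus : IsFiniteMeasure (volume.restrict (annulus O R₁ R₂)) :=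
  isFiniteMeasure_restrict.2
    ((measure_mono annulus_subset).trans_lt isCompact_closedAnnulus.measure_lt_top).ne

lemma mem_annulus_or_bdry {x : E n} (hx : x ∈ closedAnnulus O R₁ R₂) :
    x ∈ annulus O R₁ R₂ ∨ x ∈ bdry O R₁ R₂ := by
  rcases hx.1.eq_or_lt with h | h
  · exact Or.inr (Or.inl h.symm)
  · rcases hx.2.eq_or_lt with h' | h'
    · exact Or.inr (Or.inr h')
    · exact Or.inl ⟨h, h'⟩

lemma memLp_of_continuousOn {F : Type*} [NormedAddCommGroup F] [SecondCountableTopology F]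
    {g : E n → F} (hg : ContinuousOn g (closedAnnulus O R₁ R₂)) (q : ℝ≥0∞) :
    MemLp g q (volume.restrict (annulus O R₁ R₂)) := by
  obtain ⟨C, hC⟩ := isCompact_closedAnnulus.exists_bound_of_continuousOn hg
  refine MemLp.of_bound ((hg.mono annulus_subset).aestronglyMeasurable measurableSet_annulus) C ?_
  filter_upwards [ae_restrict_mem measurableSet_annulus] with x hx
  exact hC x (annulus_subset hx)

end geometry

/-! ### Integration by parts against test functions -/

section parts

variable {n : ℕ} {Ω : Set (E n)}

/-- The factor `a` is controlled only on `Ω`, but the product is continuous on the whole space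
because the closed support of `ψ` lies in the open set `Ω`. -/
lemma integrable_mul_test {a ψ : E n → ℝ} (hΩ : IsOpen Ω) (ha : ContinuousOn a Ω)
    (hψ : Continuous ψ) (hc : HasCompactSupport ψ) (hs : tsupport ψ ⊆ Ω) :
    Integrable (fun x => a x * ψ x) := by
  refine Continuous.integrable_of_hasCompactSupport ?_ hc.mul_left
  refine continuous_of_tsupport fun x hx => ?_
  have hx' : x ∈ Ω := hs (closure_mono (Function.support_mul_subset_right a ψ) hx)
  exact (ha.continuousAt (hΩ.mem_nhds hx')).mul hψ.continuousAt

lemma IsTest.continuous_fderiv_apply {φ : E n → ℝ} (h : IsTest Ω φ) (v : E n) :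
    Continuous fun x => fderiv ℝ φ x v :=
  (h.smooth.continuous_fderiv (by simp)).clm_apply continuous_const

lemma IsTest.eq_zero {φ : E n → ℝ} (h : IsTest Ω φ) {x : E n} (hx : x ∉ Ω) : φ x = 0 :=
  image_eq_zero_of_notMem_tsupport fun hx' => hx (h.support hx')

lemma IsTest.fderiv_eq_zero {φ : E n → ℝ} (h : IsTest Ω φ) {x : E n} (hx : x ∉ Ω) :
    fderiv ℝ φ x = 0 :=
  image_eq_zero_of_notMem_tsupport fun hx' => hx (h.support (tsupport_fderiv_subset ℝ hx'))

/-- All products vanish off `Ω`, so the integrals extend to the whole space, where integration by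
parts has no boundary term. -/
lemma integral_mul_fderiv_test {a : E n → ℝ} {a' : E n → E n →L[ℝ] ℝ} (hΩ : IsOpen Ω)
    (ha : ∀ x ∈ Ω, HasFDerivAt a (a' x) x) (ha' : ContinuousOn a' Ω) {φ : E n → ℝ}
    (hφ : IsTest Ω φ) (v : E n) :
    Integrable (fun x => a x * fderiv ℝ φ x v) ∧ Integrable (fun x => a' x v * φ x) ∧
    ∫ x in Ω, a x * fderiv ℝ φ x v = - ∫ x in Ω, a' x v * φ x := by
  have hac : ContinuousOn a Ω := fun x hx => (ha x hx).continuousAt.continuousWithinAt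
  have hsup : tsupport (fun x => fderiv ℝ φ x v) ⊆ tsupport φ :=
    (tsupport_fderiv_apply_subset ℝ v)
  have hi1 : Integrable (fun x => a x * fderiv ℝ φ x v) :=
    integrable_mul_test hΩ hac (hφ.continuous_fderiv_apply v)
      (hφ.compact.mono' (subset_tsupport _ |>.trans hsup)) (hsup.trans hφ.support)
  have hi2 : Integrable (fun x => a' x v * φ x) :=
    integrable_mul_test hΩ (ha'.clm_apply continuousOn_const) hφ.smooth.continuous hφ.compact
      hφ.support
  have hi3 : Integrable (fun x => a x * φ x) :=
    integrable_mul_test hΩ hac hφ.smooth.continuous hφ.compact hφ.support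
  have he : ∀ x, fderiv ℝ a x v * φ x = a' x v * φ x := fun x => by
    by_cases hx : x ∈ Ω
    · rw [(ha x hx).fderiv]
    · rw [hφ.eq_zero hx, mul_zero, mul_zero]
  refine ⟨hi1, hi2, ?_⟩
  rw [setIntegral_eq_integral_of_forall_compl_eq_zero fun x hx => by
      rw [hφ.fderiv_eq_zero hx]; simp,
    setIntegral_eq_integral_of_forall_compl_eq_zero fun x hx => by
      rw [hφ.eq_zero hx, mul_zero]]
  rw [integral_mul_fderiv_eq_neg_fderiv_mul_of_integrable (by simpa only [he] using hi2) hi1 hi3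
    (fun x hx => (ha x (hφ.support hx)).differentiableAt)
    (fun x _ => (hφ.smooth.differentiable (by simp)).differentiableAt)]
  simp only [he]

lemma isWeakGrad_of_hasFDerivAt {u : E n → ℝ} {G : E n → E n} (hΩ : IsOpen Ω)
    (hu : ∀ x ∈ Ω, HasFDerivAt u (innerSL ℝ (G x)) x) (hG : ContinuousOn G Ω) :
    IsWeakGrad Ω u G where
  locInt := ContinuousOn.locallyIntegrableOn
    (fun x hx => (hu x hx).continuousAt.continuousWithinAt) hΩ.measurableSet
  locInt_grad := hG.locallyIntegrableOn hΩ.measurableSet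
  parts _ hφ v := (integral_mul_fderiv_test (a' := fun x => innerSL ℝ (G x)) hΩ hu
    ((innerSL ℝ).continuous.comp_continuousOn hG) hφ v).2.2

/-- The fundamental lemma of the calculus of variations, applied to `G - G'`. It lets the chosen
representative `weakGrad` be replaced by a classical gradient. -/
lemma IsWeakGrad.ae_eq {u : E n → ℝ} {G G' : E n → E n} (hΩ : IsOpen Ω)
    (h : IsWeakGrad Ω u G) (h' : IsWeakGrad Ω u G') : G =ᵐ[volume.restrict Ω] G' := by
  have hl := h.locInt_grad.sub h'.locInt_grad
  have hint : ∀ {H : E n → E n}, LocallyIntegrableOn H Ω → ∀ g : E n → ℝ, IsTest Ω g →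
      Integrable (fun x => g x • H x) := by
    intro H hH g hg
    have h1 : IntegrableOn H (tsupport g) := by
      exact hH.integrableOn_compact_subset hg.support hg.compact
    rw [← integrableOn_iff_integrable_of_support_subset (s := tsupport g)]
    · have hgc : ContinuousOn g (tsupport g) := hg.smooth.continuous.continuousOn
      exact IntegrableOn.continuousOn_smul h1 hgc hg.compact
    · exact (Function.support_smul_subset_left g H).trans (subset_tsupport g)
  have key := hΩ.ae_eq_zero_of_integral_contDiff_smul_eq_zero (μ := volume) hl ?_
  · rw [EventuallyEq, ae_restrict_iff' hΩ.measurableSet]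
    filter_upwards [key] with x hx hxΩ
    exact sub_eq_zero.1 (hx hxΩ)
  · intro g hg1 hg2 hg3
    have hg : IsTest Ω g := ⟨hg1, hg2, hg3⟩
    refine ext_inner_right ℝ fun v => ?_
    have e1 := h.parts g hg v
    rw [h'.parts g hg v, neg_inj] at e1
    have hz : ∀ {H : E n → E n}, LocallyIntegrableOn H Ω →
        ∫ x in Ω, inner ℝ (H x) v * g x = inner ℝ (∫ x, g x • H x) v := by
      intro H hH
      rw [setIntegral_eq_integral_of_forall_compl_eq_zero fun x hx => by
        rw [hg.eq_zero hx, mul_zero], real_inner_comm, ← integral_inner (hint hH g hg)]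
      refine integral_congr_ae (Eventually.of_forall fun x => ?_)
      simp only [real_inner_smul_right, real_inner_comm v]
      ring
    rw [hz h.locInt_grad, hz h'.locInt_grad] at e1
    have e2 : ∫ x, g x • (G - G') x = (∫ x, g x • G x) - ∫ x, g x • G' x := by
      rw [← integral_sub (hint h.locInt_grad g hg) (hint h'.locInt_grad g hg)]
      simp only [Pi.sub_apply, smul_sub]
    rw [e2, inner_sub_left, e1, sub_self, inner_zero_left]

lemma isWeakGrad_weakGrad {u : E n → ℝ} {G : E n → E n} (h : IsWeakGrad Ω u G) :
    IsWeakGrad Ω u (weakGrad Ω u) := by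
  have hex : ∃ G, IsWeakGrad Ω u G := ⟨G, h⟩
  rw [weakGrad, dif_pos hex]
  exact hex.choose_spec

end parts

/-! ### Radial functions and fields -/

section radial

variable {n : ℕ} {O : E n}

lemma hasFDerivAt_dist {x : E n} (hx : x ≠ O) :
    HasFDerivAt (fun x => dist x O) (innerSL ℝ ((dist x O)⁻¹ • (x - O))) x := by
  have h0 : HasFDerivAt (fun x : E n => x - O) (ContinuousLinearMap.id ℝ (E n)) x :=
    (hasFDerivAt_id x).sub_const O
  have hpos : 0 < ‖x - O‖ := norm_pos_iff.2 (sub_ne_zero.2 hx)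
  have h1 := (h0.norm_sq).sqrt (by positivity)
  simp only [Real.sqrt_sq (norm_nonneg _)] at h1
  simp only [dist_eq_norm]
  refine h1.congr_fderiv ?_
  ext v
  simp
  field_simp

lemma hasFDerivAt_radial {w : ℝ → ℝ} {w' : ℝ} {x : E n} (hx : x ≠ O)
    (hw : HasDerivAt w w' (dist x O)) :
    HasFDerivAt (fun x => w (dist x O)) (innerSL ℝ ((w' / dist x O) • (x - O))) x := by
  refine (hw.comp_hasFDerivAt x (hasFDerivAt_dist hx)).congr_fderiv ?_
  ext v
  simp
  ring

lemma ne_center_of_dist_pos {x : E n} (hx : 0 < dist x O) : x ≠ O := dist_pos.1 hx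

lemma continuousOn_radial {s : Set (E n)} {I : Set ℝ} {F : Type*} [TopologicalSpace F]
    {w : ℝ → F} (hw : ContinuousOn w I) (hs : ∀ x ∈ s, dist x O ∈ I) :
    ContinuousOn (fun x => w (dist x O)) s :=
  hw.comp (by fun_prop) hs

/-- The divergence theorem for the radial field `S(|x - O|) (x - O)`. -/
lemma integral_inner_radialField {R₁ R₂ : ℝ} (hR₁ : 0 < R₁) {S S' h : ℝ → ℝ}
    (hS : ∀ r ∈ Ioo R₁ R₂, HasDerivAt S (S' r) r) (hS' : ContinuousOn S' (Ioo R₁ R₂))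
    (hdiv : ∀ r ∈ Ioo R₁ R₂, n * S r + r * S' r = -h r) {φ : E n → ℝ}
    (hφ : IsTest (annulus O R₁ R₂) φ) :
    ∫ x in annulus O R₁ R₂, inner ℝ (S (dist x O) • (x - O)) (gradient φ x) =
      ∫ x in annulus O R₁ R₂, h (dist x O) * φ x := by
  set Ω := annulus O R₁ R₂ with hΩd
  have hmem : ∀ x ∈ Ω, dist x O ∈ Ioo R₁ R₂ := fun x hx => hx
  -- Each coordinate function of the field is integrated by parts in its own direction; the trace of
  -- the derivatives is the divergence `n S + r S'`.
  let e : Fin n → E n := fun i => EuclideanSpace.single i 1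
  let a : Fin n → E n → ℝ := fun i x => S (dist x O) * (x i - O i)
  let a' : Fin n → E n → E n →L[ℝ] ℝ := fun i x =>
    S (dist x O) • EuclideanSpace.proj i +
      (x i - O i) • innerSL ℝ ((S' (dist x O) / dist x O) • (x - O))
  have ha : ∀ i, ∀ x ∈ Ω, HasFDerivAt (a i) (a' i x) x := by
    intro i x hx
    have hx0 : x ≠ O := ne_center_of_dist_pos (hR₁.trans hx.1)
    have h1 : HasFDerivAt (fun x : E n => x i - O i) (EuclideanSpace.proj i : E n →L[ℝ] ℝ) x :=
      ((EuclideanSpace.proj i : E n →L[ℝ] ℝ).hasFDerivAt (x := x)).sub_const (O i)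
    exact (hasFDerivAt_radial hx0 (hS _ (hmem x hx))).mul h1
  have hSc : ContinuousOn S (Ioo R₁ R₂) := fun r hr => (hS r hr).continuousAt.continuousWithinAt
  have ha' : ∀ i, ContinuousOn (a' i) Ω := by
    intro i
    have c1 : ContinuousOn (fun x => S (dist x O)) Ω := continuousOn_radial hSc hmem
    have c2 : ContinuousOn (fun x => S' (dist x O) / dist x O) Ω :=
      (continuousOn_radial hS' hmem).div (by fun_prop) fun x hx => (hR₁.trans hx.1).ne'
    have c3 : ContinuousOn (fun x : E n => (S' (dist x O) / dist x O) • (x - O)) Ω :=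
      c2.smul (by fun_prop)
    have c4 : ContinuousOn (fun x : E n => x i - O i) Ω := by fun_prop
    exact (c1.smul continuousOn_const).add
      (c4.smul ((innerSL ℝ).continuous.comp_continuousOn c3))
  have key := fun i => integral_mul_fderiv_test isOpen_annulus (ha i) (ha' i) hφ (e i)
  have hsum : ∀ x, inner ℝ (S (dist x O) • (x - O)) (gradient φ x) =
      ∑ i, a i x * fderiv ℝ φ x (e i) := by
    intro x
    rw [real_inner_comm, gradient, InnerProductSpace.toDual_symm_apply, map_smul]
    have : x - O = ∑ i, (x i - O i) • e i := by
      ext j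
      simp [e, Pi.single_apply]
    conv_lhs => rw [this, map_sum, smul_eq_mul, Finset.mul_sum]
    refine Finset.sum_congr rfl fun i _ => ?_
    simp only [map_smul, smul_eq_mul, a]
    ring
  simp only [hsum]
  rw [integral_finsetSum _ fun i _ => (key i).1.integrableOn]
  rw [Finset.sum_congr rfl fun i _ => (key i).2.2]
  rw [Finset.sum_neg_distrib, ← integral_finsetSum _ fun i _ => (key i).2.1.integrableOn,
    ← integral_neg]
  refine setIntegral_congr_fun measurableSet_annulus fun x hx => ?_
  have hr : dist x O ≠ 0 := (hR₁.trans hx.1).ne'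
  have hd := hdiv _ (hmem x hx)
  have hn : ∑ i, (x i - O i) ^ 2 = dist x O ^ 2 := by
    rw [EuclideanSpace.dist_eq, Real.sq_sqrt (Finset.sum_nonneg fun i _ => sq_nonneg _)]
    simp [Real.dist_eq]
  have hs2 : ∑ i, a' i x (e i) = n * S (dist x O) + dist x O * S' (dist x O) := by
    have : ∀ i, a' i x (e i) =
        S (dist x O) + S' (dist x O) / dist x O * (x i - O i) ^ 2 := by
      intro i
      simp [a', e, EuclideanSpace.inner_single_right]
      ring
    simp only [this, Finset.sum_add_distrib, ← Finset.mul_sum, hn]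
    simp
    field_simp
  rw [← Finset.sum_mul, hs2, hd]
  ring

end radial

/-! ### Convergence in `L^p` -/

section convergence

variable {α : Type*} [MeasurableSpace α] {μ : Measure α} {F : Type*} [NormedAddCommGroup F]

lemma tendsto_eLpNorm_zero_of_bounded [IsFiniteMeasure μ] {f : ℕ → α → F}
    (hm : ∀ k, AEStronglyMeasurable (f k) μ) {C : ℝ} (hb : ∀ k, ∀ᵐ x ∂μ, ‖f k x‖ ≤ C)
    (h : ∀ᵐ x ∂μ, Tendsto (fun k => f k x) atTop (𝓝 0)) {p : ℝ} (hp : 0 < p) :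
    Tendsto (fun k => eLpNorm (f k) (ENNReal.ofReal p) μ) atTop (𝓝 0) := by
  have h0 : ENNReal.ofReal p ≠ 0 := by simpa using hp
  simp only [eLpNorm_eq_lintegral_rpow_enorm_toReal h0 ENNReal.ofReal_ne_top,
    ENNReal.toReal_ofReal hp.le]
  have h1 : Tendsto (fun k => ∫⁻ x, ‖f k x‖ₑ ^ p ∂μ) atTop (𝓝 (∫⁻ _, 0 ∂μ)) := by
    refine tendsto_lintegral_of_dominated_convergence' (fun _ => ENNReal.ofReal C ^ p)
      (fun k => (hm k).enorm.pow_const p) (fun k => ?_) ?_ ?_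
    · filter_upwards [hb k] with x hx
      refine ENNReal.rpow_le_rpow ?_ hp.le
      rw [← ofReal_norm]
      exact ENNReal.ofReal_le_ofReal hx
    · rw [lintegral_const]
      exact ENNReal.mul_ne_top (ENNReal.rpow_ne_top_of_nonneg hp.le ENNReal.ofReal_ne_top)
        (measure_ne_top μ _)
    · filter_upwards [h] with x hx
      have h2 := (ENNReal.continuous_rpow_const (y := p)).tendsto 0 |>.comp
        (continuous_enorm.tendsto (0 : F) |>.comp hx |> fun h => by simpa using h)
      simpa [ENNReal.zero_rpow_of_pos hp, Function.comp_def] using h2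
  have h3 := ((ENNReal.continuous_rpow_const (y := 1 / p)).tendsto _).comp h1
  simpa [hp, Function.comp_def] using h3

variable [InnerProductSpace ℝ F]

lemma integrable_inner_of_memLp {p q : ℝ≥0∞} [ENNReal.HolderTriple q p 1] {θ G : α → F}
    (hθ : MemLp θ q μ) (hG : MemLp G p μ) : Integrable (fun x => inner ℝ (θ x) (G x)) μ := by
  refine memLp_one_iff_integrable.1 (MemLp.of_bilin (fun a b : F => inner ℝ a b) 1 hθ hG
    (hθ.1.inner hG.1) (Eventually.of_forall fun x => ?_))
  rw [one_mul]
  exact_mod_cast norm_inner_le_norm (𝕜 := ℝ) (θ x) (G x)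

lemma tendsto_integral_inner {p q : ℝ≥0∞} [ENNReal.HolderTriple q p 1] {θ G : α → F}
    {H : ℕ → α → F} (hθ : MemLp θ q μ) (hG : MemLp G p μ) (hH : ∀ k, MemLp (H k) p μ)
    (h : Tendsto (fun k => eLpNorm (fun x => H k x - G x) p μ) atTop (𝓝 0)) :
    Tendsto (fun k => ∫ x, inner ℝ (θ x) (H k x) ∂μ) atTop (𝓝 (∫ x, inner ℝ (θ x) (G x) ∂μ)) := by
  refine tendsto_integral_of_L1' _ (integrable_inner_of_memLp hθ hG).1
    (Eventually.of_forall fun k => integrable_inner_of_memLp hθ (hH k)) ?_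
  have h1 : Tendsto (fun k => eLpNorm θ q μ * eLpNorm (fun x => H k x - G x) p μ) atTop (𝓝 0) := by
    have := ENNReal.Tendsto.const_mul (a := eLpNorm θ q μ) h (Or.inr hθ.2.ne)
    rwa [mul_zero] at this
  refine tendsto_of_tendsto_of_tendsto_of_le_of_le tendsto_const_nhds h1 (fun _ => zero_le)
    fun k => ?_
  have h2 := eLpNorm_le_eLpNorm_mul_eLpNorm_of_nnnorm (r := 1) (p := q) (q := p) hθ.1
    ((hH k).1.sub hG.1) (fun a b : F => inner ℝ a b) 1 (Eventually.of_forall fun x => by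
      rw [one_mul]
      exact_mod_cast norm_inner_le_norm (𝕜 := ℝ) (θ x) ((H k - G) x))
  simpa [inner_sub_right, Pi.sub_def] using h2

end convergence

/-! ### Extension of the weak equation to `W₀^{1,p}` -/

section extension

variable {n : ℕ} {Ω : Set (E n)} {p q : ℝ}

lemma IsTest.memLp {φ : E n → ℝ} (h : IsTest Ω φ) (r : ℝ≥0∞) :
    MemLp φ r (volume.restrict Ω) :=
  (h.smooth.continuous.memLp_of_hasCompactSupport h.compact).restrict Ω

lemma IsTest.memLp_gradient {φ : E n → ℝ} (h : IsTest Ω φ) (r : ℝ≥0∞) :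
    MemLp (gradient φ) r (volume.restrict Ω) := by
  have hc : Continuous (gradient φ) :=
    (InnerProductSpace.toDual ℝ (E n)).symm.continuous.comp
      (h.smooth.continuous_fderiv (by simp))
  refine (hc.memLp_of_hasCompactSupport ?_).restrict Ω
  refine h.compact.fderiv (𝕜 := ℝ) |>.comp_left (g := (InnerProductSpace.toDual ℝ (E n)).symm) ?_
  simp

/-- A weak equation tested against test functions holds against `W₀^{1,p}`. -/
lemma MemW0.weak_eq (hpq : p.HolderConjugate q) {θ : E n → E n} {f v : E n → ℝ}
    (hθ : MemLp θ (ENNReal.ofReal q) (volume.restrict Ω))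
    (hf : MemLp f (ENNReal.ofReal q) (volume.restrict Ω))
    (heq : ∀ φ, IsTest Ω φ → ∫ x in Ω, inner ℝ (θ x) (gradient φ x) = ∫ x in Ω, f x * φ x)
    (hv : MemW0 Ω p v) :
    ∫ x in Ω, inner ℝ (θ x) (weakGrad Ω v x) = ∫ x in Ω, f x * v x := by
  have : ENNReal.HolderTriple (ENNReal.ofReal q) (ENNReal.ofReal p) 1 :=
    Real.HolderConjugate.ennrealOfReal hpq.symm
  obtain ⟨φ, hφ, h1, h2⟩ := hv.approx
  have t1 := tendsto_integral_inner hθ hv.memLp_grad (fun k => (hφ k).memLp_gradient _) h2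
  have t2 := tendsto_integral_inner hf hv.memLp (fun k => (hφ k).memLp _) h1
  simp only [fun k => heq _ (hφ k)] at t1
  have e : ∀ a b : ℝ, inner ℝ a b = a * b := fun a b => by simp [mul_comm]
  simp only [e] at t2
  exact tendsto_nhds_unique t1 t2

end extension

/-! ### Radial functions in `W₀^{1,p}` -/

section approximation

/-- A continuous function of mean zero on an interval is a bounded pointwise limit of test
functions of mean zero. -/
lemma exists_smooth_meanZero_approx {R₁ R₂ : ℝ} (hR : R₁ < R₂) {g : ℝ → ℝ} (hg : Continuous g)
    (hg0 : ∫ r in R₁..R₂, g r = 0) :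
    ∃ (γ : ℕ → ℝ → ℝ) (C : ℝ), (∀ k, ContDiff ℝ ∞ (γ k)) ∧
      (∀ k, ∃ a b, R₁ < a ∧ b < R₂ ∧ ∀ r ∉ Icc a b, γ k r = 0) ∧
      (∀ k, ∫ r in R₁..R₂, γ k r = 0) ∧ (∀ k r, |γ k r| ≤ C) ∧
      ∀ r ∈ Ioo R₁ R₂, Tendsto (fun k => γ k r) atTop (𝓝 (g r)) := by
  set m := (R₁ + R₂) / 2 with hm
  set L := (R₂ - R₁) / 2 with hL
  have hL0 : 0 < L := by rw [hL]; linarith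
  -- Both radii increase to the half-length `L` while staying below it: the plateaus exhaust the
  -- open interval and the supports stay compact inside it.
  let η : ℕ → ContDiffBump m := fun k =>
    { rIn := L * ((k + 1) / (k + 3))
      rOut := L * ((k + 2) / (k + 3))
      rIn_pos := by positivity
      rIn_lt_rOut := by gcongr; norm_num }
  have hout : ∀ k, (η k).rOut < L := fun k => by
    change L * ((k + 2) / (k + 3)) < L
    refine mul_lt_of_lt_one_right hL0 ?_
    rw [div_lt_one (by positivity)]; linarith
  have hηz : ∀ k r, r ∉ Icc (m - (η k).rOut) (m + (η k).rOut) → η k r = 0 := by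
    intro k r hr
    refine (η k).zero_of_le_dist ?_
    rw [Real.dist_eq]
    by_contra hlt
    rw [not_le, abs_lt] at hlt
    exact hr ⟨by linarith [hlt.1], by linarith [hlt.2]⟩
  have hηR : ∀ k r, r ∉ Icc R₁ R₂ → η k r = 0 := by
    intro k r hr
    refine hηz k r fun h' => hr ⟨?_, ?_⟩
    · linarith [hout k, h'.1]
    · linarith [hout k, h'.2]
  have hηt : ∀ r ∈ Ioo R₁ R₂, ∀ᶠ k in atTop, η k r = 1 := by
    intro r hr
    have ht : Tendsto (fun k : ℕ => L * (((k : ℝ) + 1) / (k + 3))) atTop (𝓝 (L * 1)) := by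
      refine Tendsto.const_mul _ ?_
      have h3 : Tendsto (fun k : ℕ => 1 - 2 * ((k : ℝ) + 3)⁻¹) atTop (𝓝 (1 - 2 * 0)) := by
        refine tendsto_const_nhds.sub (Tendsto.const_mul _ ?_)
        exact tendsto_inv_atTop_zero.comp
          (tendsto_atTop_add_const_right _ _ tendsto_natCast_atTop_atTop)
      rw [mul_zero, sub_zero] at h3
      refine h3.congr fun k => ?_
      have : (k : ℝ) + 3 ≠ 0 := by positivity
      field_simp; ring
    rw [mul_one] at ht
    have hr' : |r - m| < L := by
      rw [abs_lt]; constructor <;> rw [hm, hL] <;> linarith [hr.1, hr.2]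
    filter_upwards [ht.eventually_const_lt hr'] with k hk
    exact (η k).one_of_mem_closedBall (by rw [Metric.mem_closedBall, Real.dist_eq]; exact hk.le)
  have hq : ∀ k : ℕ, ∃ q : Polynomial ℝ, ∀ x ∈ Icc R₁ R₂, |q.eval x - g x| < 1 / ((k : ℝ) + 1) :=
    fun k => exists_polynomial_near_of_continuousOn R₁ R₂ g hg.continuousOn _ (by positivity)
  choose q hq using hq
  obtain ⟨B, hB⟩ := isCompact_Icc.exists_bound_of_continuousOn (s := Icc R₁ R₂) hg.continuousOn
  have hB0 : 0 ≤ B := (norm_nonneg _).trans (hB R₁ ⟨le_rfl, hR.le⟩)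
  -- Weierstrass polynomials supply smoothness and the cut-offs supply compact support; only the
  -- mean is still wrong.
  let ψ : ℕ → ℝ → ℝ := fun k r => η k r * (q k).eval r
  have hψs : ∀ k, ContDiff ℝ ∞ (ψ k) := fun k => (η k).contDiff.mul
    (by simpa using (q k).contDiff_aeval (𝕜 := ℝ) ∞)
  have hψb : ∀ k r, |ψ k r| ≤ B + 1 := by
    intro k r
    by_cases hr : r ∈ Icc R₁ R₂
    · have h1 := hq k r hr
      have h2 := hB r hr
      have h3 : 1 / ((k : ℝ) + 1) ≤ 1 := by
        rw [div_le_one (by positivity)]; linarith [k.cast_nonneg (α := ℝ)]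
      have h4 : |(q k).eval r| ≤ B + 1 := by
        have := abs_sub_abs_le_abs_sub ((q k).eval r) (g r)
        rw [Real.norm_eq_abs] at h2
        linarith
      change |η k r * _| ≤ _
      rw [abs_mul, abs_of_nonneg (η k).nonneg]
      exact (mul_le_of_le_one_left (abs_nonneg _) (η k).le_one).trans h4
    · change |η k r * _| ≤ _
      rw [hηR k r hr, zero_mul, abs_zero]; linarith
  have hψt : ∀ r ∈ Ioo R₁ R₂, Tendsto (fun k => ψ k r) atTop (𝓝 (g r)) := by
    intro r hr
    have h1 : Tendsto (fun k => (q k).eval r) atTop (𝓝 (g r)) := by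
      rw [tendsto_iff_dist_tendsto_zero]
      refine squeeze_zero (fun _ => dist_nonneg)
        (fun k => (hq k r ⟨hr.1.le, hr.2.le⟩).le) tendsto_one_div_add_atTop_nhds_zero_nat
    refine h1.congr' ?_
    filter_upwards [hηt r hr] with k hk
    change _ = η k r * _
    rw [hk, one_mul]
  have hψi : Tendsto (fun k => ∫ r in R₁..R₂, ψ k r) atTop (𝓝 0) := by
    rw [← hg0]
    refine intervalIntegral.tendsto_integral_filter_of_dominated_convergence (fun _ => B + 1)
      (Eventually.of_forall fun k => (hψs k).continuous.aestronglyMeasurable)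
      (Eventually.of_forall fun k => Eventually.of_forall fun r _ => hψb k r)
      intervalIntegrable_const ?_
    have hne : ∀ᵐ r : ℝ, r ≠ R₂ := by simp [ae_iff]
    filter_upwards [hne] with r hr hr'
    rw [uIoc_of_le hR.le] at hr'
    exact hψt r ⟨hr'.1, hr'.2.lt_of_ne hr⟩
  set J := ∫ r in R₁..R₂, η 0 r with hJ
  have hη0s : ContDiff ℝ ∞ (η 0) := (η 0).contDiff
  have hJ0 : 0 < J := by
    have hc : Continuous (η 0) := (η 0).continuous
    refine intervalIntegral.integral_pos hR hc.continuousOn (fun r _ => (η 0).nonneg)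
      ⟨m, ⟨by rw [hm]; linarith, by rw [hm]; linarith⟩, (η 0).pos_of_mem_ball ?_⟩
    exact Metric.mem_ball_self (η 0).rOut_pos
  -- Subtracting `c k` times the fixed bump `η 0` restores mean zero. The correction disappears in
  -- the limit because `∫ ψ k` tends to `∫ g = 0`.
  let c : ℕ → ℝ := fun k => (∫ r in R₁..R₂, ψ k r) / J
  have hct : Tendsto c atTop (𝓝 0) := by simpa using hψi.div_const J
  obtain ⟨D, hD⟩ := hct.norm.bddAbove_range
  have hD' : ∀ k, |c k| ≤ D := fun k => hD ⟨k, rfl⟩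
  refine ⟨fun k r => ψ k r - c k * η 0 r, B + 1 + D, fun k => ?_, fun k => ?_, fun k => ?_,
    fun k r => ?_, fun r hr => ?_⟩
  · exact (hψs k).sub (contDiff_const.mul hη0s)
  · have h01 : (η 0).rOut ≤ (η k).rOut := by
      change L * (((0 : ℕ) + 2 : ℝ) / ((0 : ℕ) + 3)) ≤ L * (((k : ℝ) + 2) / (k + 3))
      refine mul_le_mul_of_nonneg_left ?_ hL0.le
      rw [div_le_div_iff₀ (by positivity) (by positivity)]
      push_cast; linarith [k.cast_nonneg (α := ℝ)]
    have := hout k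
    refine ⟨m - (η k).rOut, m + (η k).rOut, by linarith, by linarith, fun r hr => ?_⟩
    change η k r * _ - c k * η 0 r = 0
    rw [hηz k r hr, hηz 0 r fun h' => hr ⟨by linarith [h'.1], by linarith [h'.2]⟩]
    ring
  · have i1 : IntervalIntegrable (ψ k) volume R₁ R₂ := (hψs k).continuous.intervalIntegrable _ _
    have i2 : IntervalIntegrable (fun r => c k * η 0 r) volume R₁ R₂ :=
      (continuous_const.mul hη0s.continuous).intervalIntegrable _ _
    rw [intervalIntegral.integral_sub i1 i2, intervalIntegral.integral_const_mul, ← hJ]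
    change _ - (∫ r in R₁..R₂, ψ k r) / J * J = 0
    rw [div_mul_cancel₀ _ hJ0.ne', sub_self]
  · refine (abs_sub _ _).trans (add_le_add (hψb k r) ?_)
    rw [abs_mul, abs_of_nonneg (η 0).nonneg]
    exact (mul_le_of_le_one_right (abs_nonneg _) (η 0).le_one).trans (hD' k)
  · simpa using (hψt r hr).sub (hct.mul_const (η 0 r))

/-- The distance fails to be smooth only at the center, near which `w` of the distance vanishes. -/
lemma isTest_radial {n : ℕ} {O : E n} {R₁ R₂ a b : ℝ} (hR₁ : 0 < R₁) (ha : R₁ < a) (hb : b < R₂)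
    {w : ℝ → ℝ} (hw : ContDiff ℝ ∞ w) (hw0 : ∀ r ∉ Icc a b, w r = 0) :
    IsTest (annulus O R₁ R₂) fun x => w (dist x O) := by
  have hz : ∀ x ∉ closedAnnulus O a b, w (dist x O) = 0 := fun x hx => hw0 _ fun h => hx h
  refine ⟨?_, HasCompactSupport.intro isCompact_closedAnnulus hz, ?_⟩
  · rw [contDiff_iff_contDiffAt]
    intro x
    by_cases hx : x = O
    · have : (fun x => w (dist x O)) =ᶠ[𝓝 x] fun _ => 0 := by
        rw [hx]
        filter_upwards [Metric.ball_mem_nhds O (hR₁.trans ha)] with y hy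
        exact hw0 _ fun h => (not_lt.2 h.1) hy
      exact contDiffAt_const.congr_of_eventuallyEq this
    · exact hw.contDiffAt.comp x (contDiffAt_id.dist ℝ contDiffAt_const hx)
  · refine (closure_minimal (t := closedAnnulus O a b) (fun x hx => ?_)
      isCompact_closedAnnulus.isClosed).trans fun x hx => ⟨ha.trans_le hx.1, hx.2.trans_lt hb⟩
    by_contra h
    exact hx (hz x h)

/-- The gradient field of the radial function with radial derivative `g`. -/
def radialGrad {n : ℕ} (O : E n) (g : ℝ → ℝ) (x : E n) : E n := (g (dist x O) / dist x O) • (x - O)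

lemma norm_radialGrad {n : ℕ} {O : E n} {g : ℝ → ℝ} {x : E n} (hx : x ≠ O) :
    ‖radialGrad O g x‖ = |g (dist x O)| := by
  have : 0 < dist x O := dist_pos.2 hx
  rw [radialGrad, norm_smul, ← dist_eq_norm, Real.norm_eq_abs, abs_div, abs_of_pos this,
    div_mul_cancel₀ _ this.ne']

lemma continuousOn_radialGrad {n : ℕ} {O : E n} {R₁ R₂ : ℝ} (hR₁ : 0 < R₁) {g : ℝ → ℝ}
    (hg : Continuous g) : ContinuousOn (radialGrad O g) (closedAnnulus O R₁ R₂) := by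
  have h1 : ContinuousOn (fun x => g (dist x O)) (closedAnnulus O R₁ R₂) := by fun_prop
  have h2 : ContinuousOn (fun x => dist x O) (closedAnnulus O R₁ R₂) := by fun_prop
  have h3 : ContinuousOn (fun x => x - O) (closedAnnulus O R₁ R₂) := by fun_prop
  exact (h1.div h2 fun x hx => (hR₁.trans_le hx.1).ne').smul h3

variable {n : ℕ} {O : E n} {R₁ R₂ : ℝ} {w g : ℝ → ℝ}

lemma isWeakGrad_radial (hR₁ : 0 < R₁) (hg : Continuous g) (hw : ∀ r, HasDerivAt w (g r) r) :
    IsWeakGrad (annulus O R₁ R₂) (fun x => w (dist x O)) (radialGrad O g) :=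
  isWeakGrad_of_hasFDerivAt isOpen_annulus
    (fun _ hx => hasFDerivAt_radial (ne_center_of_dist_pos (hR₁.trans hx.1)) (hw _))
    ((continuousOn_radialGrad hR₁ hg).mono annulus_subset)

lemma weakGrad_radial (hR₁ : 0 < R₁) (hg : Continuous g) (hw : ∀ r, HasDerivAt w (g r) r) :
    weakGrad (annulus O R₁ R₂) (fun x => w (dist x O)) =ᵐ[volume.restrict (annulus O R₁ R₂)]
      radialGrad O g := by
  have h := isWeakGrad_radial (O := O) (R₂ := R₂) hR₁ hg hw
  exact (isWeakGrad_weakGrad h).ae_eq isOpen_annulus h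

/-- The two boundary values make `g` of mean zero. Approximating `g` by test functions of mean zero
and integrating gives compactly supported radial test functions. They and their gradients converge
pointwise with uniform bounds, hence in `Lᵖ` on a set of finite measure. -/
lemma memW0_radial (hR₁ : 0 < R₁) (hR : R₁ < R₂) (hg : Continuous g)
    (hw : ∀ r, HasDerivAt w (g r) r) (hw1 : w R₁ = 0) (hw2 : w R₂ = 0) {p : ℝ} (hp : 1 < p) :
    MemW0 (annulus O R₁ R₂) p fun x => w (dist x O) := by
  have hG := isWeakGrad_radial (O := O) (R₂ := R₂) hR₁ hg hw
  have hGae := weakGrad_radial (O := O) (R₂ := R₂) hR₁ hg hw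
  have hwc : Continuous w := continuous_iff_continuousAt.2 fun r => (hw r).continuousAt
  have hFTC : ∀ r, ∫ s in R₁..r, g s = w r := fun r => by
    rw [intervalIntegral.integral_eq_sub_of_hasDerivAt (fun x _ => hw x)
      (hg.intervalIntegrable _ _), hw1, sub_zero]
  obtain ⟨γ, C, hγs, hγ0, hγi, hγb, hγt⟩ :=
    exists_smooth_meanZero_approx hR hg (by rw [hFTC, hw2])
  have hγc := fun k => (hγs k).continuous
  have hC : 0 ≤ C := (abs_nonneg _).trans (hγb 0 0)
  let W : ℕ → ℝ → ℝ := fun k r => ∫ s in R₁..r, γ k s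
  have hWd : ∀ k r, HasDerivAt (W k) (γ k r) r := fun k r =>
    intervalIntegral.integral_hasDerivAt_right ((hγc k).intervalIntegrable _ _)
      (hγc k).stronglyMeasurable.stronglyMeasurableAtFilter (hγc k).continuousAt
  have hWs : ∀ k, ContDiff ℝ ∞ (W k) := by
    intro k
    refine contDiff_infty_iff_deriv.2 ⟨fun r => (hWd k r).differentiableAt, ?_⟩
    rw [funext fun r => (hWd k r).deriv]
    exact hγs k
  have hWtest : ∀ k, IsTest (annulus O R₁ R₂) fun x => W k (dist x O) := by
    intro k
    obtain ⟨a, b, ha, hb, hab⟩ := hγ0 k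
    refine isTest_radial hR₁ ha hb (hWs k) fun r hr => ?_
    have hz : ∀ s t : ℝ, (∀ x ∈ uIcc s t, x ∉ Icc a b) → ∫ x in s..t, γ k x = 0 := by
      intro s t h
      rw [intervalIntegral.integral_congr (g := fun _ => 0) fun x hx => hab x (h x hx)]
      simp
    rw [mem_Icc, not_and_or, not_le, not_le] at hr
    rcases hr with hr | hr
    · refine hz _ _ fun x hx hx' => ?_
      rcases le_max_iff.1 hx.2 with h | h <;> linarith [hx'.1]
    · change ∫ s in R₁..r, γ k s = 0
      -- Beyond the support the primitive equals the full integral, which is zero by the mean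
      -- condition.
      rw [← intervalIntegral.integral_add_adjacent_intervals (b := R₂)
        ((hγc k).intervalIntegrable _ _) ((hγc k).intervalIntegrable _ _), hγi k, zero_add]
      refine hz _ _ fun x hx hx' => ?_
      rcases min_le_iff.1 hx.1 with h | h <;> linarith [hx'.2]
  have hWt : ∀ r ∈ Icc R₁ R₂, Tendsto (fun k => W k r) atTop (𝓝 (w r)) := by
    intro r hr
    rw [← hFTC r]
    refine intervalIntegral.tendsto_integral_filter_of_dominated_convergence (fun _ => C)
      (Eventually.of_forall fun k => (hγc k).aestronglyMeasurable)
      (Eventually.of_forall fun k => Eventually.of_forall fun r _ => hγb k r)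
      intervalIntegrable_const ?_
    have hne : ∀ᵐ s : ℝ, s ≠ R₂ := by simp [ae_iff]
    filter_upwards [hne] with s hs hs'
    rw [uIoc_of_le hr.1] at hs'
    exact hγt s ⟨hs'.1, (hs'.2.trans hr.2).lt_of_ne hs⟩
  have hWb : ∀ k, ∀ r ∈ Icc R₁ R₂, |W k r| ≤ C * (R₂ - R₁) := by
    intro k r hr
    refine (intervalIntegral.norm_integral_le_of_norm_le_const (f := γ k) (C := C)
      fun x _ => hγb k x).trans ?_
    rw [abs_of_nonneg (sub_nonneg.2 hr.1)]
    gcongr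
    exact hr.2
  have hgrad : ∀ k, ∀ x ∈ annulus O R₁ R₂,
      gradient (fun x => W k (dist x O)) x = radialGrad O (γ k) x := by
    intro k x hx
    refine HasGradientAt.gradient (hasGradientAt_iff_hasFDerivAt.2 ?_)
    exact hasFDerivAt_radial (ne_center_of_dist_pos (hR₁.trans hx.1)) (hWd k _)
  obtain ⟨B, hB⟩ := isCompact_Icc.exists_bound_of_continuousOn (s := Icc R₁ R₂) hwc.continuousOn
  obtain ⟨D, hD⟩ := isCompact_Icc.exists_bound_of_continuousOn (s := Icc R₁ R₂) hg.continuousOn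
  refine ⟨memLp_of_continuousOn (by fun_prop) _, isWeakGrad_weakGrad hG,
    (memLp_of_continuousOn (continuousOn_radialGrad hR₁ hg) _).ae_eq hGae.symm,
    fun k x => W k (dist x O), hWtest, ?_, ?_⟩
  · refine tendsto_eLpNorm_zero_of_bounded (C := C * (R₂ - R₁) + B) (fun k => ?_) (fun k => ?_) ?_
      (by linarith)
    · have := (hWs k).continuous
      exact Continuous.aestronglyMeasurable (by fun_prop)
    · filter_upwards [ae_restrict_mem measurableSet_annulus] with x hx
      exact (norm_sub_le _ _).trans (add_le_add (hWb k _ (annulus_subset hx))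
        (hB _ (annulus_subset hx)))
    · filter_upwards [ae_restrict_mem measurableSet_annulus] with x hx
      simpa using (hWt _ (annulus_subset hx)).sub_const (w (dist x O))
  · have hcongr : ∀ k, eLpNorm (fun x => gradient (fun x => W k (dist x O)) x -
        weakGrad (annulus O R₁ R₂) (fun x => w (dist x O)) x) (ENNReal.ofReal p)
        (volume.restrict (annulus O R₁ R₂)) =
        eLpNorm (fun x => radialGrad O (fun r => γ k r - g r) x) (ENNReal.ofReal p)
        (volume.restrict (annulus O R₁ R₂)) := by
      intro k
      refine eLpNorm_congr_ae ?_
      filter_upwards [hGae, ae_restrict_mem measurableSet_annulus] with x hx hxΩ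
      rw [hx, hgrad k x hxΩ, radialGrad, radialGrad, radialGrad, ← sub_smul, sub_div]
    simp only [hcongr]
    refine tendsto_eLpNorm_zero_of_bounded (C := C + D) (fun k => ?_) (fun k => ?_) ?_
      (by linarith)
    · exact ((continuousOn_radialGrad hR₁ ((hγc k).sub hg)).mono
        annulus_subset).aestronglyMeasurable measurableSet_annulus
    · filter_upwards [ae_restrict_mem measurableSet_annulus] with x hx
      rw [norm_radialGrad (ne_center_of_dist_pos (hR₁.trans hx.1))]
      exact (abs_sub _ _).trans (add_le_add (hγb k _) (hD _ (annulus_subset hx)))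
    · filter_upwards [ae_restrict_mem measurableSet_annulus] with x hx
      have h1 := (hγt _ hx).sub_const (g (dist x O))
      rw [sub_self] at h1
      have h2 := (h1.div_const (dist x O)).smul_const (x - O)
      rwa [zero_div, zero_smul] at h2

end approximation

/-! ### The radial ordinary differential equation -/

/-- The primitive `∫_{R₁}^r F(s) s^{n-1} ds`. -/
def radialPrimitive (n : ℕ) (R₁ : ℝ) (F : ℝ → ℝ) (r : ℝ) : ℝ := ∫ s in R₁..r, F s * s ^ (n - 1)

/-- The profile `S` for which `div (S(|x - O|) (x - O)) = -F(|x - O|)`. -/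
def radialProfile (n : ℕ) (R₁ : ℝ) (F : ℝ → ℝ) (c r : ℝ) : ℝ :=
  (c - radialPrimitive n R₁ F r) / r ^ n

/-- The radial field `S(|x - O|) (x - O)`. -/
def radialField {n : ℕ} (O : E n) (R₁ : ℝ) (F : ℝ → ℝ) (c : ℝ) (x : E n) : E n :=
  radialProfile n R₁ F c (dist x O) • (x - O)

section field

variable {n : ℕ} {R₁ R₂ : ℝ} {F : ℝ → ℝ}

lemma hasDerivAt_radialPrimitive (hF : Continuous F) (r : ℝ) :
    HasDerivAt (radialPrimitive n R₁ F) (F r * r ^ (n - 1)) r := by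
  have hc : Continuous fun s => F s * s ^ (n - 1) := by fun_prop
  exact intervalIntegral.integral_hasDerivAt_right (hc.intervalIntegrable _ _)
    hc.stronglyMeasurable.stronglyMeasurableAtFilter hc.continuousAt

lemma continuous_radialPrimitive (hF : Continuous F) : Continuous (radialPrimitive n R₁ F) :=
  continuous_iff_continuousAt.2 fun r => (hasDerivAt_radialPrimitive hF r).continuousAt

lemma continuousOn_radialProfile (hF : Continuous F) (c : ℝ) :
    ContinuousOn (radialProfile n R₁ F c) (Ioi 0) := by
  have := continuous_radialPrimitive (n := n) (R₁ := R₁) hF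
  refine ContinuousOn.div (Continuous.continuousOn (by fun_prop))
    (Continuous.continuousOn (by fun_prop)) fun r hr => ?_
  have : 0 < r := hr
  positivity

/-- This is `(rⁿ S)' = -F rⁿ⁻¹` solved for `S'`, in the form needed for the divergence identity. -/
lemma hasDerivAt_radialProfile (hn : 1 ≤ n) (hF : Continuous F) (c : ℝ) {r : ℝ} (hr : 0 < r) :
    HasDerivAt (radialProfile n R₁ F c) ((-F r - n * radialProfile n R₁ F c r) / r) r := by
  have h1 := ((hasDerivAt_radialPrimitive (n := n) (R₁ := R₁) hF r).const_sub c).div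
    (hasDerivAt_pow n r) (by positivity)
  refine h1.congr_deriv ?_
  -- Removes the truncated subtraction in the exponent `n - 1`.
  obtain ⟨m, rfl⟩ : ∃ m, n = m + 1 := ⟨n - 1, by omega⟩
  rw [radialProfile]
  simp only [Nat.add_sub_cancel]
  field_simp
  ring

variable {O : E n}

lemma continuousOn_radialField (hR₁ : 0 < R₁) (hF : Continuous F) (c : ℝ) :
    ContinuousOn (radialField O R₁ F c) (closedAnnulus O R₁ R₂) := by
  have h1 : ContinuousOn (fun x => radialProfile n R₁ F c (dist x O)) (closedAnnulus O R₁ R₂) :=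
    continuousOn_radial (continuousOn_radialProfile hF c) fun x hx => hR₁.trans_le hx.1
  exact h1.smul (by fun_prop)

lemma integral_inner_radialField_gradient (hn : 1 ≤ n) (hR₁ : 0 < R₁) (hF : Continuous F) (c : ℝ)
    {φ : E n → ℝ} (hφ : IsTest (annulus O R₁ R₂) φ) :
    ∫ x in annulus O R₁ R₂, inner ℝ (radialField O R₁ F c x) (gradient φ x) =
      ∫ x in annulus O R₁ R₂, F (dist x O) * φ x := by
  have hsub : Ioo R₁ R₂ ⊆ Ioi 0 := fun r hr => hR₁.trans hr.1
  refine integral_inner_radialField hR₁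
    (fun r hr => hasDerivAt_radialProfile hn hF c (hsub hr)) ?_ ?_ hφ
  · refine ContinuousOn.div ?_ continuousOn_id fun r hr => (hR₁.trans hr.1).ne'
    exact (hF.neg.continuousOn).sub
      (continuousOn_const.mul ((continuousOn_radialProfile hF c).mono hsub))
  · intro r hr
    have : r ≠ 0 := (hR₁.trans hr.1).ne'
    field_simp
    ring

/-- The constant of integration for which the radial solution vanishes on both spheres. -/
lemma exists_radial_derivative {p δ : ℝ} (h : Regime p δ) (hR₁ : 0 < R₁) (hR : R₁ < R₂)
    (hF : Continuous F) (n : ℕ) :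
    ∃ (c : ℝ) (g : ℝ → ℝ), Continuous g ∧ ∫ r in R₁..R₂, g r = 0 ∧
      ∀ r ∈ Icc R₁ R₂, flow p δ (g r) = r * radialProfile n R₁ F c r := by
  obtain ⟨ψ, hψc, hψm, hψ0, hψ⟩ := exists_flow_inverse h
  have hPc := continuous_radialPrimitive (n := n) (R₁ := R₁) hF
  -- The truncation `max r R₁` makes `Y` jointly continuous on the whole plane and changes nothing
  -- for `r ≥ R₁`.
  let Y : ℝ → ℝ → ℝ := fun c r => r * ((c - radialPrimitive n R₁ F r) / (max r R₁) ^ n)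
  have hYc : Continuous (Function.uncurry Y) := by
    have h1 : Continuous fun z : ℝ × ℝ =>
        (z.1 - radialPrimitive n R₁ F z.2) / (max z.2 R₁) ^ n := by
      refine Continuous.div (by fun_prop) (by fun_prop) fun z => ?_
      have : 0 < max z.2 R₁ := lt_max_of_lt_right hR₁
      positivity
    exact continuous_snd.mul h1
  have hKc : Continuous fun c => ∫ r in R₁..R₂, ψ (Y c r) :=
    intervalIntegral.continuous_parametric_intervalIntegral_of_continuous'
      (f := fun c r => ψ (Y c r)) (hψc.comp hYc) R₁ R₂
  obtain ⟨M, hM⟩ := isCompact_Icc.exists_bound_of_continuousOn (s := Icc R₁ R₂) hPc.continuousOn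
  have hM' : ∀ r ∈ Icc R₁ R₂, |radialPrimitive n R₁ F r| ≤ M := hM
  obtain ⟨c, hc⟩ : ∃ c, ∫ r in R₁..R₂, ψ (Y c r) = 0 := by
    -- Since `M` bounds the primitive in absolute value, the integrand is nonpositive at `c = -M`
    -- and nonnegative at `c = M`.
    refine mem_range_of_exists_le_of_exists_ge hKc ⟨-M, ?_⟩ ⟨M, ?_⟩
    · rw [← neg_nonneg, ← intervalIntegral.integral_neg]
      refine intervalIntegral.integral_nonneg hR.le fun r hr => neg_nonneg.2 ?_
      rw [← hψ0]
      have hr0 : 0 < max r R₁ := lt_max_of_lt_right hR₁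
      refine hψm (mul_nonpos_of_nonneg_of_nonpos (hR₁.le.trans hr.1)
        (div_nonpos_of_nonpos_of_nonneg ?_ (by positivity)))
      linarith [(abs_le.1 (hM' r hr)).1]
    · refine intervalIntegral.integral_nonneg hR.le fun r hr => ?_
      rw [← hψ0]
      have hr0 : 0 < max r R₁ := lt_max_of_lt_right hR₁
      refine hψm (mul_nonneg (hR₁.le.trans hr.1) (div_nonneg ?_ (by positivity)))
      linarith [(abs_le.1 (hM' r hr)).2]
  refine ⟨c, fun r => ψ (Y c r), hψc.comp (hYc.comp (by fun_prop : Continuous fun r => (c, r))),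
    hc, fun r hr => ?_⟩
  rw [hψ, radialProfile]
  simp only [Y]
  rw [max_eq_left hr.1]

/-- A radially symmetric function is a continuous function of the distance to the center. -/
lemma exists_continuous_profile (hn : 1 ≤ n) (hR₁ : 0 < R₁) (hR : R₁ < R₂) {f : E n → ℝ}
    (hf : ContinuousOn f (closedAnnulus O R₁ R₂)) (hfr : RadialOn O (closedAnnulus O R₁ R₂) f) :
    ∃ F : ℝ → ℝ, Continuous F ∧ ∀ x ∈ closedAnnulus O R₁ R₂, f x = F (dist x O) := by
  let e : E n := EuclideanSpace.single ⟨0, hn⟩ 1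
  have he : ‖e‖ = 1 := by simp [e]
  -- The profile samples `f` along one ray, with the radius clamped to `[R₁, R₂]` so that it is
  -- continuous on all of `ℝ`.
  let y : ℝ → E n := fun r => O + (max R₁ (min r R₂)) • e
  have hyd : ∀ r, dist (y r) O = max R₁ (min r R₂) := fun r => by
    have : 0 < max R₁ (min r R₂) := lt_max_of_lt_left hR₁
    rw [dist_eq_norm, add_sub_cancel_left, norm_smul, he, mul_one, Real.norm_eq_abs,
      abs_of_pos this]
  have hy : ∀ r, y r ∈ closedAnnulus O R₁ R₂ := fun r => by
    rw [closedAnnulus, mem_ofPred_eq, hyd]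
    exact ⟨le_max_left _ _, max_le hR.le (min_le_right _ _)⟩
  refine ⟨fun r => f (y r), hf.comp_continuous (by fun_prop) hy, fun x hx => ?_⟩
  refine hfr x hx _ (hy _) ?_
  rw [hyd, min_eq_left hx.2, max_eq_right hx.1]

end field

/-! ### Estimates for the flux and the energy density -/

section flux

variable {n : ℕ} {Ω : Set (E n)} {p ε : ℝ} {v : E n → ℝ}

/-- For `p < 2` the regularization lowers a power with negative exponent; for `p > 2` it is absent.
This growth bound of order `p - 1` places the flux in the conjugate Lebesgue space. -/
lemma coeff_le (h : Regime p (chi p * ε ^ 2)) {s : ℝ} (hs : 0 ≤ s) :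
    flow p (chi p * ε ^ 2) s ≤ s ^ (p - 1) := by
  have hp1 := h.one_lt
  rcases hs.eq_or_lt with rfl | hs
  · rw [flow_zero, Real.zero_rpow (by linarith)]
  have e : s ^ (p - 1) = (s ^ 2) ^ ((p - 2) / 2) * s := by
    rw [← Real.rpow_natCast, ← Real.rpow_mul hs.le, ← Real.rpow_add_one hs.ne']
    congr 1; push_cast; ring
  rw [e, flow]
  refine mul_le_mul_of_nonneg_right ?_ hs.le
  rcases h.cases with ⟨hp, hδ⟩ | ⟨hp, hδ⟩
  · exact Real.rpow_le_rpow_of_nonpos (by positivity) (by linarith) (by linarith)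
  · rw [hδ, add_zero]

lemma aemeasurable_coeff (hv : MemW0 Ω p v) :
    AEMeasurable (fun x => Phi Ω p ε v x ^ ((p - 2) / 2)) (volume.restrict Ω) :=
  ((hv.memLp_grad.1.norm.aemeasurable.pow_const 2).add_const _).pow_const _

lemma norm_flux (h : Regime p (chi p * ε ^ 2)) (x : E n) :
    ‖flux Ω p ε v x‖ = flow p (chi p * ε ^ 2) ‖weakGrad Ω v x‖ := by
  rw [flux, norm_smul, Phi, Real.norm_of_nonneg (Real.rpow_nonneg (h.base_nonneg _) _), flow]

lemma inner_flux (x : E n) :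
    inner ℝ (flux Ω p ε v x) (weakGrad Ω v x) =
      (‖weakGrad Ω v x‖ ^ 2 + chi p * ε ^ 2) ^ ((p - 2) / 2) * ‖weakGrad Ω v x‖ ^ 2 := by
  rw [flux, real_inner_smul_left, real_inner_self_eq_norm_sq, Phi]

lemma MemW0.memLp_flux (h : Regime p (chi p * ε ^ 2)) (hv : MemW0 Ω p v) {q : ℝ}
    (hpq : p.HolderConjugate q) :
    MemLp (flux Ω p ε v) (ENNReal.ofReal q) (volume.restrict Ω) := by
  have hp1 : 0 < p - 1 := by linarith [h.one_lt]
  have h1 := hv.memLp_grad.norm_rpow_div (ENNReal.ofReal (p - 1))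
  rw [← ENNReal.ofReal_div_of_pos hp1, ENNReal.toReal_ofReal hp1.le, ← hpq.conjugate_eq] at h1
  refine h1.of_le ((aemeasurable_coeff hv).aestronglyMeasurable.smul hv.memLp_grad.1)
    (Eventually.of_forall fun x => ?_)
  rw [norm_flux h, Real.norm_of_nonneg (Real.rpow_nonneg (norm_nonneg _) _)]
  exact coeff_le h (norm_nonneg _)

lemma MemW0.integrable_inner_flux (h : Regime p (chi p * ε ^ 2)) {u : E n → ℝ}
    (hu : MemW0 Ω p u) (hv : MemW0 Ω p v) :
    IntegrableOn (fun x => inner ℝ (flux Ω p ε u x) (weakGrad Ω v x)) Ω := by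
  have hpq := Real.HolderConjugate.conjExponent h.one_lt
  have : ENNReal.HolderTriple (ENNReal.ofReal p.conjExponent) (ENNReal.ofReal p) 1 :=
    Real.HolderConjugate.ennrealOfReal hpq.symm
  exact integrable_inner_of_memLp (hu.memLp_flux h hpq) hv.memLp_grad

lemma dens_nonneg (h : Regime p (chi p * ε ^ 2)) (s : ℝ) : 0 ≤ dens p (chi p * ε ^ 2) s :=
  div_nonneg (Real.rpow_nonneg (h.base_nonneg _) _) h.p_pos.le

lemma MemW0.integrable_dens [IsFiniteMeasure (volume.restrict Ω)]
    (h : Regime p (chi p * ε ^ 2)) (hv : MemW0 Ω p v) :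
    IntegrableOn (fun x => dens p (chi p * ε ^ 2) ‖weakGrad Ω v x‖) Ω := by
  have hm : AEMeasurable (fun x => dens p (chi p * ε ^ 2) ‖weakGrad Ω v x‖)
      (volume.restrict Ω) :=
    (((hv.memLp_grad.1.norm.aemeasurable.pow_const 2).add_const _).pow_const _).div_const _
  refine Integrable.mono' ((integrable_const (dens p (chi p * ε ^ 2) 0)).add
    (hv.integrable_inner_flux h hv)) hm.aestronglyMeasurable (Eventually.of_forall fun x => ?_)
  rw [Real.norm_of_nonneg (dens_nonneg h _)]
  -- The tangent at `|∇v|`, evaluated at `0`, bounds the density by a constant plus the integrable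
  -- product of flux and gradient.
  have h1 := dens_tangent h ‖weakGrad Ω v x‖ 0
  simp only [Pi.add_apply]
  rw [inner_flux]
  rw [flow] at h1
  linarith

lemma MemW0.weak_eq_flux {f u : E n → ℝ} (h : Regime p (chi p * ε ^ 2)) (hu : MemW0 Ω p u)
    (hf : ∀ q : ℝ≥0∞, MemLp f q (volume.restrict Ω))
    (heq : ∀ φ, IsTest Ω φ →
      ∫ x in Ω, inner ℝ (flux Ω p ε u x) (gradient φ x) = ∫ x in Ω, f x * φ x)
    (hv : MemW0 Ω p v) :
    ∫ x in Ω, inner ℝ (flux Ω p ε u x) (weakGrad Ω v x) = ∫ x in Ω, f x * v x := by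
  have hpq := Real.HolderConjugate.conjExponent h.one_lt
  exact hv.weak_eq hpq (hu.memLp_flux h hpq) (hf _) heq

end flux

/-! ### Existence of the radial solution -/

section existence

variable {n : ℕ} {O : E n} {R₁ R₂ p ε : ℝ} {f : E n → ℝ}

/-- A radial solution is described by its radial derivative `g`, and by the profile of its flux. -/
structure IsProfile (O : E n) (R₁ R₂ p ε c : ℝ) (F g : ℝ → ℝ) (u : E n → ℝ) : Prop where
  cont : Continuous g
  grad : ∀ x ∈ closedAnnulus O R₁ R₂, HasFDerivAt u (innerSL ℝ (radialGrad O g x)) x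
  flow_eq : ∀ r ∈ Icc R₁ R₂, flow p (chi p * ε ^ 2) (g r) = r * radialProfile n R₁ F c r
  weakGrad_eq : weakGrad (annulus O R₁ R₂) u =ᵐ[volume.restrict (annulus O R₁ R₂)] radialGrad O g

lemma flow_radialGrad {c : ℝ} {F g : ℝ → ℝ} {δ : ℝ} {x : E n} (hx : x ≠ O)
    (h : flow p δ (g (dist x O)) = dist x O * radialProfile n R₁ F c (dist x O)) :
    (g (dist x O) ^ 2 + δ) ^ ((p - 2) / 2) • radialGrad O g x = radialField O R₁ F c x := by
  have hd : dist x O ≠ 0 := dist_ne_zero.2 hx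
  rw [radialGrad, radialField, smul_smul]
  congr 1
  rw [← mul_div_assoc, div_eq_iff hd]
  rw [flow] at h
  rw [h, mul_comm]

lemma IsProfile.flux_eq {c : ℝ} {F g : ℝ → ℝ} {u : E n → ℝ} (hR₁ : 0 < R₁)
    (h : IsProfile O R₁ R₂ p ε c F g u) :
    radialField O R₁ F c =ᵐ[volume.restrict (annulus O R₁ R₂)]
      flux (annulus O R₁ R₂) p ε u := by
  filter_upwards [h.weakGrad_eq, ae_restrict_mem measurableSet_annulus] with x hx hxΩ
  have hx0 : x ≠ O := ne_center_of_dist_pos (hR₁.trans hxΩ.1)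
  rw [flux, Phi, hx, norm_radialGrad hx0, sq_abs,
    flow_radialGrad hx0 (h.flow_eq _ (annulus_subset hxΩ))]

lemma exists_radialSolution (hn : 1 ≤ n) (hR₁ : 0 < R₁) (hR : R₁ < R₂)
    (h : Regime p (chi p * ε ^ 2)) {F : ℝ → ℝ} (hF : Continuous F)
    (hfF : ∀ x ∈ closedAnnulus O R₁ R₂, f x = F (dist x O)) :
    ∃ (c : ℝ) (g : ℝ → ℝ) (u : E n → ℝ), IsProfile O R₁ R₂ p ε c F g u ∧
      IsRadialSolution O R₁ R₂ p ε f u := by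
  obtain ⟨c, g, hg, hg0, hgF⟩ := exists_radial_derivative h hR₁ hR hF n
  let w : ℝ → ℝ := fun r => ∫ s in R₁..r, g s
  have hw : ∀ r, HasDerivAt w (g r) r := fun r =>
    intervalIntegral.integral_hasDerivAt_right (hg.intervalIntegrable _ _)
      hg.stronglyMeasurable.stronglyMeasurableAtFilter hg.continuousAt
  have hw1 : w R₁ = 0 := intervalIntegral.integral_same
  have hwc : Continuous w := continuous_iff_continuousAt.2 fun r => (hw r).continuousAt
  have hprof : IsProfile O R₁ R₂ p ε c F g fun x => w (dist x O) :=
    ⟨hg, fun x hx => hasFDerivAt_radial (ne_center_of_dist_pos (hR₁.trans_le hx.1)) (hw _), hgF,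
      weakGrad_radial hR₁ hg hw⟩
  refine ⟨c, g, fun x => w (dist x O), hprof,
    ⟨memW0_radial hR₁ hR hg hw hw1 hg0 h.one_lt, by fun_prop, fun x _ y _ hxy => ?_⟩,
    fun φ hφ => ?_, fun x hx => ?_⟩
  · simp only [hxy]
  · have e1 : ∫ x in annulus O R₁ R₂, f x * φ x = ∫ x in annulus O R₁ R₂, F (dist x O) * φ x :=
      setIntegral_congr_fun measurableSet_annulus fun x hx => by
        simp only [hfF x (annulus_subset hx)]
    rw [e1, ← integral_inner_radialField_gradient hn hR₁ hF c hφ]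
    refine integral_congr_ae ?_
    filter_upwards [hprof.flux_eq hR₁] with x hx
    rw [hx]
  · rcases hx with hx | hx
    · rw [mem_sphere_iff_norm, ← dist_eq_norm] at hx
      simp only [hx, hw1]
    · rw [mem_sphere_iff_norm, ← dist_eq_norm] at hx
      simp only [hx]
      exact hg0

lemma IsProfile.hasLineIntegralForm {c : ℝ} {F g : ℝ → ℝ} {u : E n → ℝ} (hR₁ : 0 < R₁)
    (hε : 0 < ε) (hreg : Regime p (chi p * ε ^ 2)) (hF : Continuous F)
    (h : IsProfile O R₁ R₂ p ε c F g u) (hu : ∀ x ∈ bdry O R₁ R₂, u x = 0) :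
    HasLineIntegralForm O R₁ R₂ p ε u := by
  have hgc := h.cont
  have hne : ∀ x ∈ closedAnnulus O R₁ R₂, x ≠ O := fun x hx =>
    ne_center_of_dist_pos (hR₁.trans_le hx.1)
  have hfield : ∀ x ∈ closedAnnulus O R₁ R₂,
      (g (dist x O) ^ 2 + chi p * ε ^ 2) ^ ((p - 2) / 2) • radialGrad O g x =
        radialField O R₁ F c x := fun x hx => flow_radialGrad (hne x hx) (h.flow_eq _ hx)
  refine ⟨radialField O R₁ F c,
    fun x => (g (dist x O) ^ 2 + chi p * ε ^ 2) ^ ((p - 2) / 2),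
    continuousOn_radialField hR₁ hF c, ?_, h.flux_eq hR₁, ?_, fun x hx => ⟨?_, ?_⟩, ?_⟩
  · exact ((continuous_coeff hreg).comp (by fun_prop : Continuous fun x => g (dist x O))).continuousOn
  · filter_upwards [h.weakGrad_eq, ae_restrict_mem measurableSet_annulus] with x hx hxΩ
    rw [dualVar, Phi, hx, norm_radialGrad (hne x (annulus_subset hxΩ)), sq_abs,
      mul_div_cancel₀ _ two_ne_zero]
  · exact coeff_mem_Edom hreg hε _
  · rw [Efun_coeff hreg, ← hfield x hx, norm_smul, norm_radialGrad (hne x hx),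
      Real.norm_of_nonneg (Real.rpow_nonneg (hreg.base_nonneg _) _), mul_pow, mul_pow, sq_abs]
  · intro x₀ x γ hx₀ hγ hγm
    -- The quotient is the classical gradient of `u`, so the claim is the fundamental theorem of
    -- calculus along the path. In the degenerate case both sides vanish because `g` does.
    have hquot : ∀ y ∈ closedAnnulus O R₁ R₂,
        ((g (dist y O) ^ 2 + chi p * ε ^ 2) ^ ((p - 2) / 2))⁻¹ • radialField O R₁ F c y =
          radialGrad O g y := by
      intro y hy
      rw [← hfield y hy]
      rcases hreg.base_pos_or (g (dist y O)) with hs | ⟨-, -, hs⟩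
      · rw [inv_smul_smul₀ (Real.rpow_pos_of_pos hs _).ne']
      · rw [radialGrad, hs]; simp
    have hmem : ∀ t, γ.extend t ∈ closedAnnulus O R₁ R₂ := fun t => hγm _
    have hd : ContinuousOn (derivWithin γ.extend (Icc 0 1)) (Icc 0 1) :=
      hγ.continuousOn_derivWithin (uniqueDiffOn_Icc zero_lt_one) le_rfl
    have hrc : ContinuousOn (fun t => radialGrad O g (γ.extend t)) (Icc 0 1) :=
      (continuousOn_radialGrad hR₁ hgc).comp γ.continuous_extend.continuousOn fun t _ => hmem t
    have hint : ∀ t, curveIntegralFun (fun y => innerSL ℝ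
        (((g (dist y O) ^ 2 + chi p * ε ^ 2) ^ ((p - 2) / 2))⁻¹ • radialField O R₁ F c y)) γ t =
        inner ℝ (radialGrad O g (γ.extend t)) (derivWithin γ.extend (Icc 0 1) t) := by
      intro t
      rw [curveIntegralFun_def, hquot _ (hmem t)]
      rfl
    rw [curveIntegral_def]
    simp only [hint]
    have hder : ∀ t ∈ Ioo (0 : ℝ) 1, HasDerivAt (fun t => u (γ.extend t))
        (inner ℝ (radialGrad O g (γ.extend t)) (derivWithin γ.extend (Icc 0 1) t)) t := by
      intro t ht
      have h1 : HasDerivAt γ.extend (derivWithin γ.extend (Icc 0 1) t) t :=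
        ((hγ.differentiableOn one_ne_zero t ⟨ht.1.le, ht.2.le⟩).hasDerivWithinAt).hasDerivAt
          (Icc_mem_nhds ht.1 ht.2)
      exact (h.grad _ (hmem t)).comp_hasDerivAt t h1
    have huc : Continuous fun t => u (γ.extend t) :=
      continuous_iff_continuousAt.2 fun t =>
        (h.grad _ (hmem t)).continuousAt.comp γ.continuous_extend.continuousAt
    rw [intervalIntegral.integral_eq_sub_of_hasDerivAt_of_le zero_le_one huc.continuousOn hder
      ((hrc.inner hd).intervalIntegrable_of_Icc zero_le_one)]
    simp [hu x₀ hx₀]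

end existence

/-! ### Uniqueness -/

section uniqueness

variable {n : ℕ} {O : E n} {R₁ R₂ p ε : ℝ} {f u v : E n → ℝ}

lemma IsRadialSolution.weak_eq (h : Regime p (chi p * ε ^ 2))
    (hf : ContinuousOn f (closedAnnulus O R₁ R₂)) (hu : IsRadialSolution O R₁ R₂ p ε f u)
    (hv : MemW0 (annulus O R₁ R₂) p v) :
    ∫ x in annulus O R₁ R₂, inner ℝ (flux (annulus O R₁ R₂) p ε u x)
      (weakGrad (annulus O R₁ R₂) v x) = ∫ x in annulus O R₁ R₂, f x * v x :=
  hu.mem.1.weak_eq_flux h (fun q => memLp_of_continuousOn hf q) hu.eqn hv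

/-- Testing both equations with both solutions shows that the monotonicity integrand has integral
zero. Being nonnegative, it vanishes almost everywhere, and the equality case applies. -/
lemma IsRadialSolution.weakGrad_ae_eq (h : Regime p (chi p * ε ^ 2))
    (hf : ContinuousOn f (closedAnnulus O R₁ R₂)) (hu : IsRadialSolution O R₁ R₂ p ε f u)
    (hv : IsRadialSolution O R₁ R₂ p ε f v) :
    weakGrad (annulus O R₁ R₂) u =ᵐ[volume.restrict (annulus O R₁ R₂)]
      weakGrad (annulus O R₁ R₂) v := by
  set Ω := annulus O R₁ R₂
  have iuu := hu.mem.1.integrable_inner_flux h hu.mem.1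
  have iuv := hu.mem.1.integrable_inner_flux h hv.mem.1
  have ivu := hv.mem.1.integrable_inner_flux h hu.mem.1
  have ivv := hv.mem.1.integrable_inner_flux h hv.mem.1
  have hsplit : (fun x => inner ℝ (flux Ω p ε u x - flux Ω p ε v x)
      (weakGrad Ω u x - weakGrad Ω v x)) = fun x =>
      (inner ℝ (flux Ω p ε u x) (weakGrad Ω u x) - inner ℝ (flux Ω p ε u x) (weakGrad Ω v x)) -
      (inner ℝ (flux Ω p ε v x) (weakGrad Ω u x) - inner ℝ (flux Ω p ε v x) (weakGrad Ω v x)) := by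
    funext x
    simp only [inner_sub_left, inner_sub_right]
    ring
  have hzero : ∫ x in Ω, inner ℝ (flux Ω p ε u x - flux Ω p ε v x)
      (weakGrad Ω u x - weakGrad Ω v x) = 0 := by
    rw [hsplit, integral_sub (iuu.fun_sub iuv) (ivu.fun_sub ivv), integral_sub iuu iuv,
      integral_sub ivu ivv, hu.weak_eq h hf hu.mem.1, hu.weak_eq h hf hv.mem.1,
      hv.weak_eq h hf hu.mem.1, hv.weak_eq h hf hv.mem.1, sub_self]
  have hi : IntegrableOn (fun x => inner ℝ (flux Ω p ε u x - flux Ω p ε v x)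
      (weakGrad Ω u x - weakGrad Ω v x)) Ω := by
    rw [hsplit]
    exact (iuu.sub iuv).sub (ivu.sub ivv)
  have h0 := (integral_eq_zero_iff_of_nonneg (fun x => flux_monotone h _ _) hi).1 hzero
  filter_upwards [h0] with x hx
  exact eq_of_flux_inner_eq_zero h _ _ hx

/-- A duality argument in place of a Poincaré inequality. The difference `u - v` is itself radial,
with profile `F`, so an explicit field has divergence `-F`. Testing this field with `u` and `v`,
whose gradients agree, gives `∫ (u - v)² = 0`; continuity removes the null set. -/
lemma eqOn_of_weakGrad_ae_eq (hn : 1 ≤ n) (hR₁ : 0 < R₁) (hR : R₁ < R₂) (hp : 1 < p)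
    (hu : u ∈ feasible O R₁ R₂ p) (hv : v ∈ feasible O R₁ R₂ p)
    (huv : weakGrad (annulus O R₁ R₂) u =ᵐ[volume.restrict (annulus O R₁ R₂)]
      weakGrad (annulus O R₁ R₂) v) : EqOn u v (annulus O R₁ R₂) := by
  set Ω := annulus O R₁ R₂ with hΩ
  have hpq := Real.HolderConjugate.conjExponent hp
  have hc : ContinuousOn (fun x => u x - v x) (closedAnnulus O R₁ R₂) := hu.2.1.sub hv.2.1
  obtain ⟨F, hF, hFe⟩ := exists_continuous_profile hn hR₁ hR hc
    (fun x hx y hy hxy => by simp only [hu.2.2 x hx y hy hxy, hv.2.2 x hx y hy hxy])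
  have hFd : ContinuousOn (fun x => F (dist x O)) (closedAnnulus O R₁ R₂) := by fun_prop
  -- The constant of integration is taken to be `0`; its value does not affect the divergence.
  have key : ∀ {w}, MemW0 Ω p w → ∫ x in Ω, inner ℝ (radialField O R₁ F 0 x) (weakGrad Ω w x) =
      ∫ x in Ω, F (dist x O) * w x := fun hw =>
    hw.weak_eq hpq (memLp_of_continuousOn (continuousOn_radialField hR₁ hF 0) _)
      (memLp_of_continuousOn hFd _)
      fun φ hφ => integral_inner_radialField_gradient hn hR₁ hF 0 hφ
  have hFu : IntegrableOn (fun x => F (dist x O) * u x) Ω :=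
    memLp_one_iff_integrable.1 (memLp_of_continuousOn (hFd.mul hu.2.1) 1)
  have hFv : IntegrableOn (fun x => F (dist x O) * v x) Ω :=
    memLp_one_iff_integrable.1 (memLp_of_continuousOn (hFd.mul hv.2.1) 1)
  have hi : IntegrableOn (fun x => (u x - v x) ^ 2) Ω :=
    memLp_one_iff_integrable.1 (memLp_of_continuousOn (hc.pow 2) 1)
  have hzero : ∫ x in Ω, (u x - v x) ^ 2 = 0 := by
    have e : ∫ x in Ω, (u x - v x) ^ 2 =
        ∫ x in Ω, (F (dist x O) * u x - F (dist x O) * v x) :=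
      setIntegral_congr_fun measurableSet_annulus fun x hx => by
        simp only [← hFe x (annulus_subset hx)]
        ring
    rw [e, integral_sub hFu hFv, ← key hu.1, ← key hv.1, sub_eq_zero]
    refine integral_congr_ae ?_
    filter_upwards [huv] with x hx
    rw [hx]
  have h0 := (integral_eq_zero_iff_of_nonneg (fun x => sq_nonneg _) hi).1 hzero
  refine Measure.eqOn_open_of_ae_eq (μ := volume) ?_ isOpen_annulus
    (hu.2.1.mono annulus_subset) (hv.2.1.mono annulus_subset)
  filter_upwards [h0] with x hx
  exact sub_eq_zero.1 (pow_eq_zero_iff two_ne_zero |>.1 hx)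

lemma IsRadialSolution.eqOn (hn : 1 ≤ n) (hR₁ : 0 < R₁) (hR : R₁ < R₂)
    (h : Regime p (chi p * ε ^ 2)) (hf : ContinuousOn f (closedAnnulus O R₁ R₂))
    (hu : IsRadialSolution O R₁ R₂ p ε f u) (hv : IsRadialSolution O R₁ R₂ p ε f v) :
    EqOn u v (closedAnnulus O R₁ R₂) := by
  intro x hx
  rcases mem_annulus_or_bdry hx with hx | hx
  · exact eqOn_of_weakGrad_ae_eq hn hR₁ hR h.one_lt hu.mem hv.mem
      (hu.weakGrad_ae_eq h hf hv) hx
  · rw [hu.bc x hx, hv.bc x hx]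

end uniqueness

/-! ### The primal problem -/

section primal

variable {n : ℕ} {O : E n} {R₁ R₂ p ε : ℝ} {f u v : E n → ℝ}

lemma MemW0.integrable_mul (hp : 1 < p) (hf : ContinuousOn f (closedAnnulus O R₁ R₂))
    (hv : MemW0 (annulus O R₁ R₂) p v) : IntegrableOn (fun x => f x * v x) (annulus O R₁ R₂) := by
  have hpq := Real.HolderConjugate.conjExponent hp
  have : ENNReal.HolderTriple (ENNReal.ofReal p.conjExponent) (ENNReal.ofReal p) 1 :=
    Real.HolderConjugate.ennrealOfReal hpq.symm
  exact (memLp_of_continuousOn hf (ENNReal.ofReal p.conjExponent)).integrable_mul hv.memLp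

/-- Integrate the tangent inequality at `∇u`. The weak equation turns its linear term into `∫ f v -
∫ f u`, which is the difference of the load terms. -/
lemma IsRadialSolution.isMinOn_primalEnergy (h : Regime p (chi p * ε ^ 2))
    (hf : ContinuousOn f (closedAnnulus O R₁ R₂)) (hu : IsRadialSolution O R₁ R₂ p ε f u) :
    IsMinOn (primalEnergy (annulus O R₁ R₂) p ε f) (feasible O R₁ R₂ p) u := by
  intro v hv
  set Ω := annulus O R₁ R₂
  change (∫ x in Ω, dens p (chi p * ε ^ 2) ‖weakGrad Ω u x‖) - ∫ x in Ω, f x * u x ≤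
    (∫ x in Ω, dens p (chi p * ε ^ 2) ‖weakGrad Ω v x‖) - ∫ x in Ω, f x * v x
  have iuu := hu.mem.1.integrable_inner_flux h hu.mem.1
  have iuv := hu.mem.1.integrable_inner_flux h hv.1
  have h1 : ∫ x in Ω, (dens p (chi p * ε ^ 2) ‖weakGrad Ω u x‖ +
      (inner ℝ (flux Ω p ε u x) (weakGrad Ω v x) - inner ℝ (flux Ω p ε u x) (weakGrad Ω u x))) ≤
      ∫ x in Ω, dens p (chi p * ε ^ 2) ‖weakGrad Ω v x‖ := by
    refine integral_mono ((hu.mem.1.integrable_dens h).add (iuv.sub iuu)) (hv.1.integrable_dens h)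
      fun x => ?_
    have := dens_tangent_vec h (weakGrad Ω u x) (weakGrad Ω v x)
    rw [inner_sub_right] at this
    exact this
  rw [integral_add (hu.mem.1.integrable_dens h) (iuv.fun_sub iuu), integral_sub iuv iuu,
    hu.weak_eq h hf hu.mem.1, hu.weak_eq h hf hv.1] at h1
  linarith

end primal

/-! ### The dual problem -/

section dual

variable {n : ℕ} {Ω : Set (E n)}

/-- Neither measurability nor finiteness is needed, so competitors with infinite energy require no
separate treatment. -/
lemma eintegral_mono {g h : E n → EReal} (hgh : ∀ᵐ x ∂(volume.restrict Ω), g x ≤ h x) :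
    eintegral Ω g ≤ eintegral Ω h := by
  refine EReal.sub_le_sub ?_ ?_
  · refine EReal.coe_ennreal_le_coe_ennreal_iff.2 (lintegral_mono_ae ?_)
    filter_upwards [hgh] with x hx
    exact EReal.toENNReal_le_toENNReal hx
  · refine EReal.coe_ennreal_le_coe_ennreal_iff.2 (lintegral_mono_ae ?_)
    filter_upwards [hgh] with x hx
    exact EReal.toENNReal_le_toENNReal (EReal.neg_le_neg_iff.2 hx)

lemma eintegral_coe {g : E n → ℝ} (hg : IntegrableOn g Ω) :
    eintegral Ω (fun x => (g x : EReal)) = ((∫ x in Ω, g x : ℝ) : EReal) := by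
  have e1 : ∀ x, (g x : EReal).toENNReal = ENNReal.ofReal (g x) := fun x => by
    simp
  have e2 : ∀ x, (-(g x : EReal)).toENNReal = ENNReal.ofReal (-g x) := fun x => by
    rw [← EReal.coe_neg]; simp
  have h1 : ∫⁻ x in Ω, ENNReal.ofReal (g x) ≠ ⊤ := hg.lintegral_lt_top.ne
  have h2 : ∫⁻ x in Ω, ENNReal.ofReal (-g x) ≠ ⊤ := hg.neg.lintegral_lt_top.ne
  rw [integral_eq_lintegral_pos_part_sub_lintegral_neg_part hg, eintegral]
  simp only [e1, e2]
  rw [EReal.coe_sub, EReal.coe_ennreal_toReal h1, EReal.coe_ennreal_toReal h2]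

variable {p ε : ℝ} {f u ζ : E n → ℝ}

/-- For `p < 2` the bounds are those of `Edom`, halved. For `p > 2` the variable is `|∇u|^{p-2}/2`,
which is in `L^{p/(p-2)}` because `∇u` is in `Lᵖ`. -/
lemma dualVar_mem_dualSpace (h : Regime p (chi p * ε ^ 2)) (hε : 0 < ε) (hu : MemW0 Ω p u) :
    dualVar Ω p ε u ∈ dualSpace Ω p ε := by
  have hm : AEStronglyMeasurable (dualVar Ω p ε u) (volume.restrict Ω) :=
    ((aemeasurable_coeff hu).div_const 2).aestronglyMeasurable
  rw [dualSpace]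
  split_ifs with hp
  · refine ⟨hm, Eventually.of_forall fun x => ?_⟩
    have h1 := coeff_mem_Edom h hε ‖weakGrad Ω u x‖
    rw [Edom, if_pos hp] at h1
    exact ⟨half_pos h1.1, div_le_div_of_nonneg_right h1.2 zero_le_two⟩
  · rcases h.cases with h' | ⟨hp2, hδ⟩
    · exact absurd h'.1 hp
    have hp2' : 0 < p - 2 := by linarith
    refine ⟨?_, Eventually.of_forall fun x =>
      div_nonneg (Real.rpow_nonneg (h.base_nonneg _) _) zero_le_two⟩
    have h1 := hu.memLp_grad.norm_rpow_div (ENNReal.ofReal (p - 2))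
    rw [← ENNReal.ofReal_div_of_pos hp2', ENNReal.toReal_ofReal hp2'.le] at h1
    refine h1.of_le hm (Eventually.of_forall fun x => ?_)
    rw [dualVar, Phi, hδ, add_zero, ← Real.rpow_natCast, ← Real.rpow_mul (norm_nonneg _)]
    have e : ((2 : ℕ) : ℝ) * ((p - 2) / 2) = p - 2 := by push_cast; ring
    have h2 := Real.rpow_nonneg (norm_nonneg (weakGrad Ω u x)) (p - 2)
    rw [e, Real.norm_of_nonneg (by positivity), Real.norm_of_nonneg h2]
    linarith

/-- The density of the total complementary energy at the dual variable. -/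
lemma totalEnergy_dualVar (h : Regime p (chi p * ε ^ 2)) :
    totalEnergy Ω p ε f u (dualVar Ω p ε u) =
      eintegral Ω fun x => ((dens p (chi p * ε ^ 2) ‖weakGrad Ω u x‖ - f x * u x : ℝ) : EReal) := by
  rw [totalEnergy]
  congr 1
  funext x
  rw [← legendre_eq h]
  rfl

/-- The density of the pure complementary energy at the dual variable. -/
lemma pureEnergy_dualVar (h : Regime p (chi p * ε ^ 2)) :
    pureEnergy Ω p ε u (dualVar Ω p ε u) =
      eintegral Ω fun x => ((dens p (chi p * ε ^ 2) ‖weakGrad Ω u x‖ -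
        (‖weakGrad Ω u x‖ ^ 2 + chi p * ε ^ 2) ^ ((p - 2) / 2) * ‖weakGrad Ω u x‖ ^ 2 : ℝ) :
          EReal) := by
  rw [pureEnergy]
  congr 1
  funext x
  rw [norm_flux h, dualVar, Phi]
  rcases h.base_pos_or ‖weakGrad Ω u x‖ with hs | ⟨hp, hδ, hs⟩
  · have hL := Real.rpow_pos_of_pos hs ((p - 2) / 2)
    rw [← pure_eq h hs, ← ENNReal.ofReal_div_of_pos (by positivity), EReal.coe_ennreal_ofReal,
      max_eq_left (by positivity), ← EReal.coe_sub]
    rfl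
  -- At a critical point with `p > 2` both flux and dual variable vanish. The quotient `0/0` in
  -- `ℝ≥0∞` is `0`, as are all powers, whose exponents are nonzero.
  · have h1 : p / 2 ≠ 0 := by linarith
    have h2 : (p - 2) / 2 ≠ 0 := by linarith
    have h3 : p / (p - 2) ≠ 0 := div_ne_zero (by linarith) (by linarith)
    rw [hs, hδ, flow_zero]
    simp [dens, PsiStar, Real.zero_rpow h1, Real.zero_rpow h2, Real.zero_rpow h3]

lemma isMinOn_totalEnergy (h : Regime p (chi p * ε ^ 2)) (hp : p < 2) :
    IsMinOn (totalEnergy Ω p ε f u) (dualSpace Ω p ε) (dualVar Ω p ε u) := by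
  intro ζ hζ
  rw [dualSpace, if_pos hp] at hζ
  simp only [mem_ofPred_eq]
  rw [totalEnergy_dualVar h, totalEnergy]
  refine eintegral_mono ?_
  filter_upwards [hζ.2] with x hx
  exact EReal.coe_le_coe_iff.2 (sub_le_sub_right (le_legendre h hp _ hx.1) _)

lemma isMaxOn_totalEnergy (h : Regime p (chi p * ε ^ 2)) (hp : 2 < p) :
    IsMaxOn (totalEnergy Ω p ε f u) (dualSpace Ω p ε) (dualVar Ω p ε u) := by
  intro ζ hζ
  rw [dualSpace, if_neg hp.not_gt] at hζ
  simp only [mem_ofPred_eq]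
  rw [totalEnergy_dualVar h, totalEnergy]
  refine eintegral_mono ?_
  filter_upwards [hζ.2] with x hx
  exact EReal.coe_le_coe_iff.2 (sub_le_sub_right (legendre_le h hp _ hx) _)

lemma isMinOn_pureEnergy (h : Regime p (chi p * ε ^ 2)) (hp : p < 2) :
    IsMinOn (pureEnergy Ω p ε u) (dualSpace Ω p ε) (dualVar Ω p ε u) := by
  intro ζ hζ
  rw [dualSpace, if_pos hp] at hζ
  simp only [mem_ofPred_eq]
  rw [pureEnergy_dualVar h, pureEnergy]
  refine eintegral_mono ?_
  filter_upwards [hζ.2] with x hx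
  have hx0 := hx.1
  rw [norm_flux h, ← ENNReal.ofReal_div_of_pos (by positivity), EReal.coe_ennreal_ofReal,
    max_eq_left (by positivity), ← EReal.coe_sub]
  exact EReal.coe_le_coe_iff.2 (le_pure h hp _ hx0)

lemma isMaxOn_pureEnergy (h : Regime p (chi p * ε ^ 2)) (hp : 2 < p) :
    IsMaxOn (pureEnergy Ω p ε u) (dualSpace Ω p ε) (dualVar Ω p ε u) := by
  intro ζ hζ
  rw [dualSpace, if_neg hp.not_gt] at hζ
  simp only [mem_ofPred_eq]
  rw [pureEnergy_dualVar h, pureEnergy]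
  refine eintegral_mono ?_
  filter_upwards [hζ.2] with x hx
  rw [norm_flux h]
  rcases hx.eq_or_lt with hx0 | hx0
  · rw [← hx0]
    -- Where `ζ = 0` and the flux vanishes, the competitor's integrand is `0`, below a nonnegative
    -- density. Where the flux does not vanish, the quotient is `⊤` and the integrand is `⊥`.
    by_cases hθ : flow p (chi p * ε ^ 2) ‖weakGrad Ω u x‖ = 0
    · have hs : ‖weakGrad Ω u x‖ = 0 := (flow_strictMono h).injective (hθ.trans flow_zero.symm)
      have h3 : p / (p - 2) ≠ 0 := div_ne_zero (by linarith) (by linarith)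
      rw [hθ, hs]
      simpa [PsiStar, Real.zero_rpow h3] using dens_nonneg h 0
    · have h4 : ENNReal.ofReal (flow p (chi p * ε ^ 2) ‖weakGrad Ω u x‖ ^ 2) ≠ 0 := by
        rw [Ne, ENNReal.ofReal_eq_zero, not_le]
        positivity
      rw [mul_zero 4, ENNReal.ofReal_zero, ENNReal.div_zero h4]
      simp
  · rw [← ENNReal.ofReal_div_of_pos (by positivity), EReal.coe_ennreal_ofReal,
      max_eq_left (by positivity), ← EReal.coe_sub]
    exact EReal.coe_le_coe_iff.2 (pure_le h hp _ hx0)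

end dual

/-! ### Absence of a duality gap -/

section gap

variable {n : ℕ} {O : E n} {R₁ R₂ p ε : ℝ} {f u : E n → ℝ}

lemma IsRadialSolution.totalEnergy_eq (h : Regime p (chi p * ε ^ 2))
    (hf : ContinuousOn f (closedAnnulus O R₁ R₂)) (hu : IsRadialSolution O R₁ R₂ p ε f u) :
    ((primalEnergy (annulus O R₁ R₂) p ε f u : ℝ) : EReal) =
      totalEnergy (annulus O R₁ R₂) p ε f u (dualVar (annulus O R₁ R₂) p ε u) := by
  have i1 := hu.mem.1.integrable_dens h
  have i2 := hu.mem.1.integrable_mul h.one_lt hf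
  rw [totalEnergy_dualVar h, eintegral_coe (i1.fun_sub i2), integral_sub i1 i2]
  rfl

/-- The two densities differ only in the subtracted term, `f u` against the product of flux and
gradient. Their integrals agree by testing the equation with `u` itself. -/
lemma IsRadialSolution.pureEnergy_eq (h : Regime p (chi p * ε ^ 2))
    (hf : ContinuousOn f (closedAnnulus O R₁ R₂)) (hu : IsRadialSolution O R₁ R₂ p ε f u) :
    totalEnergy (annulus O R₁ R₂) p ε f u (dualVar (annulus O R₁ R₂) p ε u) =
      pureEnergy (annulus O R₁ R₂) p ε u (dualVar (annulus O R₁ R₂) p ε u) := by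
  have i1 := hu.mem.1.integrable_dens h
  have i2 := hu.mem.1.integrable_mul h.one_lt hf
  have i3 := hu.mem.1.integrable_inner_flux h hu.mem.1
  have e := hu.weak_eq h hf hu.mem.1
  simp only [inner_flux] at i3 e
  rw [totalEnergy_dualVar h, pureEnergy_dualVar h, eintegral_coe (i1.fun_sub i2),
    eintegral_coe (i1.fun_sub i3), integral_sub i1 i2, integral_sub i1 i3, e]

end gap

end PLap

end

/-! ### Assembly of the duality theorem -/

theorem lemma2p7 {n : ℕ} (hn : 1 ≤ n) (O : PLap.E n) (R₁ R₂ : ℝ) (hR₁ : 0 < R₁) (hR : R₁ < R₂)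
    (p : ℝ) (hp : 1 < p) (hp2 : p ≠ 2) (f : PLap.E n → ℝ)
    (hf : ContinuousOn f (PLap.closedAnnulus O R₁ R₂))
    (hfrad : PLap.RadialOn O (PLap.closedAnnulus O R₁ R₂) f)
    (hsgn : (∀ x ∈ PLap.closedAnnulus O R₁ R₂, 0 < f x) ∨
      (∀ x ∈ PLap.closedAnnulus O R₁ R₂, f x < 0))
    (Ω : Set (PLap.E n)) (hΩ : Ω = PLap.annulus O R₁ R₂) :
    ∃ u : ℝ → PLap.E n → ℝ, ∀ ε : ℝ, 0 < ε →
      -- existence and uniqueness of the radially symmetric solution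
      PLap.IsRadialSolution O R₁ R₂ p ε f (u ε) ∧
      (∀ v, PLap.IsRadialSolution O R₁ R₂ p ε f v →
        Set.EqOn v (u ε) (PLap.closedAnnulus O R₁ R₂)) ∧
      PLap.HasLineIntegralForm O R₁ R₂ p ε (u ε) ∧
      -- global minimizer of the primal problem
      IsMinOn (PLap.primalEnergy Ω p ε f) (PLap.feasible O R₁ R₂ p) (u ε) ∧
      -- global extremum of the dual problem
      PLap.dualVar Ω p ε (u ε) ∈ PLap.dualSpace Ω p ε ∧
      (p < 2 →
        IsMinOn (PLap.pureEnergy Ω p ε (u ε)) (PLap.dualSpace Ω p ε)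
          (PLap.dualVar Ω p ε (u ε)) ∧
        IsMinOn (PLap.totalEnergy Ω p ε f (u ε)) (PLap.dualSpace Ω p ε)
          (PLap.dualVar Ω p ε (u ε))) ∧
      (2 < p →
        IsMaxOn (PLap.pureEnergy Ω p ε (u ε)) (PLap.dualSpace Ω p ε)
          (PLap.dualVar Ω p ε (u ε)) ∧
        IsMaxOn (PLap.totalEnergy Ω p ε f (u ε)) (PLap.dualSpace Ω p ε)
          (PLap.dualVar Ω p ε (u ε))) ∧
      -- no duality gap
      ((PLap.primalEnergy Ω p ε f (u ε) : ℝ) : EReal) =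
        PLap.totalEnergy Ω p ε f (u ε) (PLap.dualVar Ω p ε (u ε)) ∧
      PLap.totalEnergy Ω p ε f (u ε) (PLap.dualVar Ω p ε (u ε)) =
        PLap.pureEnergy Ω p ε (u ε) (PLap.dualVar Ω p ε (u ε)) := by
  subst hΩ
  obtain ⟨F, hF, hfF⟩ := PLap.exists_continuous_profile hn hR₁ hR hf hfrad
  -- The positivity of `ε` is placed inside the existential so that `choose` yields a family indexed
  -- by all reals, with the dummy value `0` for `ε ≤ 0`.
  have key : ∀ ε : ℝ, ∃ u : PLap.E n → ℝ, 0 < ε → PLap.IsRadialSolution O R₁ R₂ p ε f u ∧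
      PLap.HasLineIntegralForm O R₁ R₂ p ε u := by
    intro ε
    by_cases hε : 0 < ε
    · have h := PLap.regime_chi hp hp2 hε
      obtain ⟨c, g, u, hprof, hu⟩ := PLap.exists_radialSolution hn hR₁ hR h hF hfF
      exact ⟨u, fun _ => ⟨hu, hprof.hasLineIntegralForm hR₁ hε h hF hu.bc⟩⟩
    · exact ⟨0, fun hε' => absurd hε' hε⟩
  choose u hu using key
  refine ⟨u, fun ε hε => ?_⟩
  obtain ⟨hsol, hline⟩ := hu ε hε
  have h := PLap.regime_chi hp hp2 hε
  exact ⟨hsol, fun v hv => hv.eqOn hn hR₁ hR h hf hsol, hline, hsol.isMinOn_primalEnergy h hf,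
    PLap.dualVar_mem_dualSpace h hε hsol.mem.1,
    fun hp => ⟨PLap.isMinOn_pureEnergy h hp, PLap.isMinOn_totalEnergy h hp⟩,
    fun hp => ⟨PLap.isMaxOn_pureEnergy h hp, PLap.isMaxOn_totalEnergy h hp⟩,
    hsol.totalEnergy_eq h hf, hsol.pureEnergy_eq h hf⟩
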